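/- **Setting.** Let $\varphi:\mathbb R^n\to\mathbb R$, $f:\mathbb R^n\to\mathbb R^m$, let $\Theta\subset\mathbb R^m$ be closed and convex, and consider $$\min\varphi(x)\quad\text{subject to}\quad f(x)\in\Theta,\qquad \Omega:=\{x\in\mathbb R^n: f(x)\in\Theta\}.$$ Let $\bar x\in\Omega$, and let $\varphi$ and $f$ be twice differentiable at $\bar x$ (differentiable on a neighborhood of $\bar x$, with derivative differentiable at $\bar x$). Put $\bar v:=-\nabla\varphi(\bar x)$ and $L(x,\lambda):=\varphi(x)+\langle\lambda,f(x)\rangle$. **Notation.** Let $S$ be a set in a Euclidean space and $y\in S$. * $T_S(y)$ is the set of limits of $w_k$ with $y+t_kw_k\in S$ for some $t_k\downarrow0$. * $\widehat N_S(y)$ is the set of $v$ with $\limsup_{z\to y,\,z\in S}\langle v,z-y\rangle/\|z-y\|\le0$; $N_S(y)$ is the limiting normal cone, i.e. the set of limits of $v_k\in\widehat N_S(y_k)$ with $y_k\in S$, $y_k\to y$. * $K_S(y,v):=\{w\in T_S(y):\langle v,w\rangle=0\}$ is the critical cone. * $T^2_S(y,w)$ is the set of limits of $u_k$ with $y+t_kw+\tfrac12t_k^2u_k\in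 S$ for some $t_k\downarrow0$. * $S$ is *parabolically derivable* at $y$ for $w$ if $T^2_S(y,w)\neq\emptyset$ and for every $u\in T_S^2(y,w)$ there are $\varepsilon>0$ and $\xi:[0,\varepsilon]\to S$ with $\xi(0)=y$, $\lim_{t\downarrow0}(\xi(t)-y)/t=w$ and $\lim_{t\downarrow0}(\xi(t)-y-tw)/(\tfrac12t^2)=u$. * $\delta_S$ is the indicator function ($0$ on $S$, $\infty$ elsewhere). Put $\Delta^2_t\delta_S(y,v)(u):=\dfrac{\delta_S(y+tu)-\delta_S(y)-t\langle v,u\rangle}{\frac12t^2}$ and $\mathrm d^2\delta_S(y,v)(w):=\liminf_{t\downarrow0,\,u\to w}\Delta^2_t\delta_S(y,v)(u)$. * $S$ is *parabolically regular* at $y$ for $v$ if, for every $w$ with $\mathrm d^2\delta_S(y,v)(w)<\infty$, there are $t_k\downarrow0$ and $w_k\to w$ with $\Delta^2_{t_k}\delta_S(y,v)(w_k)\to\mathrm d^2\delta_S(y,v)(w)$ and $\limsup_k\|w_k-w\|/t_k<\infty$. * $\Lambda:=\{\lambda\in N_\Theta(f(\bar x)):\nabla f(\bar x)^*\lambda=\bar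 v\}$ is the set of Lagrange multipliers. **Assumptions.** 1. $\bar v\in N_\Omega(\bar x)$. 2. The metric subregularity constraint qualification holds with some modulus $\kappa>0$: the mapping $x\mapsto f(x)-\Theta$ is metrically subregular at $(\bar x,0)$ with this modulus, i.e. $\operatorname{dist}(x;\Omega)\le\kappa\operatorname{dist}(f(x);\Theta)$ for all $x$ near $\bar x$. 3. For every $\lambda\in\Lambda$, $\Theta$ is parabolically derivable at $f(\bar x)$ for every vector $\nabla f(\bar x)w$ that lies in $K_\Theta(f(\bar x),\lambda)$. 4. For every $\lambda\in\Lambda$, $\Theta$ is parabolically regular at $f(\bar x)$ for $\lambda$. **Theorem 7.1.** For $w\in K_\Omega(\bar x,\bar v)$ the maximum $$M(w):=\max_{\lambda\in\Lambda}\big\{\langle\nabla^2_{xx}L(\bar x,\lambda)w,w\rangle+\mathrm d^2\delta_\Theta(f(\bar x),\lambda)(\nabla f(\bar x)w)\big\}$$ is attained, and the following hold. (i) If $\bar x$ is a local minimizer of the problem, then $M(w)\ge0$ for all $w\in K_\Omega(\bar x,\bar v)$. (ii) One has $M(w)>0$ for all $w\in K_\Omega(\bar x,\bar v)\setminus\{0\}$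 if and only if there are $\ell>0$ and $\varepsilon>0$ such that $\psi:=\varphi+\delta_\Theta\circ f$ satisfies $$\psi(x)\ge\psi(\bar x)+\tfrac{\ell}{2}\|x-\bar x\|^2\quad\text{for all }x\text{ with }\|x-\bar x\|\le\varepsilon.$$ In this case $\bar x$ is a strict local minimizer of the problem. -/

import Mathlib

open Filter Topology

namespace VarAnalysis

section Geometry

variable {E : Type*} [NormedAddCommGroup E] [InnerProductSpace ℝ E]

/-- The (Bouligand-Severi) tangent cone to `Ω` at `x`: all limits of `w k` such that
`x + t k • w k ∈ Ω` for some `t k ↓ 0`. -/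
def tangentCone (Ω : Set E) (x : E) : Set E :=
  {w | ∃ (t : ℕ → ℝ) (w' : ℕ → E), Tendsto t atTop (𝓝[>] 0) ∧ Tendsto w' atTop (𝓝 w) ∧
    ∀ k, x + t k • w' k ∈ Ω}

/-- The regular (Fréchet) normal cone to `Ω` at `x ∈ Ω`:
the upper limit of `⟪v, y - x⟫ / ‖y - x‖` as `y → x` in `Ω` is nonpositive. -/
def regularNormalCone (Ω : Set E) (x : E) : Set E :=
  {v | ∀ ε > 0, ∀ᶠ y in 𝓝[Ω] x, inner ℝ v (y - x) ≤ ε * ‖y - x‖}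

/-- The limiting (Mordukhovich) normal cone to `Ω` at `x ∈ Ω`. -/
def limitingNormalCone (Ω : Set E) (x : E) : Set E :=
  {v | ∃ (x' v' : ℕ → E), (∀ k, x' k ∈ Ω) ∧ Tendsto x' atTop (𝓝 x) ∧ Tendsto v' atTop (𝓝 v) ∧
    ∀ k, v' k ∈ regularNormalCone Ω (x' k)}

/-- The critical cone `T_Ω(x) ∩ {v}^⊥`. -/
def criticalCone (Ω : Set E) (x v : E) : Set E :=
  {w | w ∈ tangentCone Ω x ∧ inner ℝ v w = 0}

/-- The second-order tangent set to `Ω` at `x` for `w`. -/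
def secondTangentSet (Ω : Set E) (x w : E) : Set E :=
  {u | ∃ (t : ℕ → ℝ) (u' : ℕ → E), Tendsto t atTop (𝓝[>] 0) ∧ Tendsto u' atTop (𝓝 u) ∧
    ∀ k, x + t k • w + ((t k) ^ 2 / 2) • u' k ∈ Ω}

/-- `Ω` is parabolically derivable at `x` for `w`: the second-order tangent set is nonempty, and
each of its elements `u` is the right second derivative at `0` of an arc
`ξ : [0, ε] → Ω` with `ξ 0 = x` and right derivative `w` at `0`. -/
def ParabolicallyDerivable (Ω : Set E) (x w : E) : Prop :=
  (secondTangentSet Ω x w).Nonempty ∧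
    ∀ u ∈ secondTangentSet Ω x w, ∃ ε > (0 : ℝ), ∃ ξ : ℝ → E,
      (∀ t ∈ Set.Icc 0 ε, ξ t ∈ Ω) ∧ ξ 0 = x ∧
      Tendsto (fun t : ℝ => t⁻¹ • (ξ t - ξ 0)) (𝓝[>] 0) (𝓝 w) ∧
      Tendsto (fun t : ℝ => (t ^ 2 / 2)⁻¹ • (ξ t - ξ 0 - t • w)) (𝓝[>] 0) (𝓝 u)

open Classical in
/-- The indicator function `δ_Ω` of convex analysis: `0` on `Ω` and `∞` elsewhere. -/
noncomputable def indicatorFun (Ω : Set E) (x : E) : EReal :=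
  if x ∈ Ω then 0 else ⊤

/-- The second-order difference quotient
`Δ_t² φ(x, v)(u) = (φ(x + t u) - φ(x) - t ⟪v, u⟫) / (t² / 2)`. -/
noncomputable def secondQuotient (φ : E → EReal) (x v : E) (t : ℝ) (u : E) : EReal :=
  (φ (x + t • u) - φ x - ((t * inner ℝ v u : ℝ) : EReal)) / ((t ^ 2 / 2 : ℝ) : EReal)

/-- The second subderivative `d²φ(x, v)(w)`: the lower limit of `Δ_t² φ(x, v)(u)` as
`t ↓ 0` and `u → w`. -/
noncomputable def secondSubderivative (φ : E → EReal) (x v w : E) : EReal :=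
  liminf (fun p : ℝ × E => secondQuotient φ x v p.1 p.2) (𝓝[>] (0 : ℝ) ×ˢ 𝓝 w)

/-- `Ω` is parabolically regular at `x` for `v`: whenever `d²δ_Ω(x, v)(w) < ∞`, this lower limit
is attained along some `t k ↓ 0` and `w' k → w` for which `‖w' k - w‖ / t k` has a finite
upper limit. -/
def ParabolicallyRegular (Ω : Set E) (x v : E) : Prop :=
  ∀ w : E, secondSubderivative (indicatorFun Ω) x v w < ⊤ →
    ∃ (t : ℕ → ℝ) (w' : ℕ → E), Tendsto t atTop (𝓝[>] 0) ∧ Tendsto w' atTop (𝓝 w) ∧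
      Tendsto (fun k => secondQuotient (indicatorFun Ω) x v (t k) (w' k)) atTop
        (𝓝 (secondSubderivative (indicatorFun Ω) x v w)) ∧
      ∃ C : ℝ, ∀ᶠ k in atTop, ‖w' k - w‖ / t k ≤ C

end Geometry

section Problem

variable {E F : Type*} [NormedAddCommGroup E] [InnerProductSpace ℝ E]
  [NormedAddCommGroup F] [InnerProductSpace ℝ F]

/-- `g` is twice differentiable at `x`: it is (Fréchet) differentiable on a neighborhood of `x`,
and its derivative is differentiable at `x`. -/
def TwiceDifferentiableAt (g : E → F) (x : E) : Prop :=
  (∀ᶠ y in 𝓝 x, DifferentiableAt ℝ g y) ∧ DifferentiableAt ℝ (fderiv ℝ g) x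

/-- The set-valued mapping `S` is metrically subregular at `(x, y) ∈ gph S` with modulus `κ`:
`dist(z; S⁻¹(y)) ≤ κ dist(y; S(z))` for all `z` in a neighborhood of `x`. Distances take values
in `[0, ∞]`, the distance to the empty set being `∞`. -/
def MetricallySubregular (S : E → Set F) (x : E) (y : F) (κ : ℝ) : Prop :=
  y ∈ S x ∧ ∀ᶠ z in 𝓝 x,
    Metric.infEDist z {z' | y ∈ S z'} ≤ ENNReal.ofReal κ * Metric.infEDist y (S z)

/-- The metric subregularity constraint qualification at `x`, with modulus `κ`, for the constraint
system `{x | f x ∈ Θ}`: the mapping `z ↦ f z - Θ` is metrically subregular at `(x, 0)`. -/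
def MSCQ (f : E → F) (Θ : Set F) (x : E) (κ : ℝ) : Prop :=
  MetricallySubregular (fun z => (fun θ => f z - θ) '' Θ) x 0 κ

/-- The set `Λ(x, v)` of Lagrange multipliers: all `lam ∈ N_Θ(f x)` with `∇f(x)^* lam = v`. -/
def lagrangeMultipliers [CompleteSpace E] [CompleteSpace F] (f : E → F) (Θ : Set F) (x v : E) :
    Set F :=
  {lam | lam ∈ limitingNormalCone Θ (f x) ∧ ContinuousLinearMap.adjoint (fderiv ℝ f x) lam = v}

/-- The Lagrangian `L(x, lam) = φ(x) + ⟪lam, f(x)⟫`. -/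
noncomputable def lagrangian (φ : E → ℝ) (f : E → F) (x : E) (lam : F) : ℝ :=
  φ x + inner ℝ lam (f x)

/-- The quantity `⟪∇²_xx L(x, lam) w, w⟫ + d²δ_Θ(f x, lam)(∇f(x) w)`. -/
noncomputable def secondOrderForm (φ : E → ℝ) (f : E → F) (Θ : Set F) (x w : E) (lam : F) :
    EReal :=
  ((fderiv ℝ (fderiv ℝ (fun z => lagrangian φ f z lam)) x w w : ℝ) : EReal) +
    secondSubderivative (indicatorFun Θ) (f x) lam (fderiv ℝ f x w)

/-- The essential objective `ψ = φ + δ_Θ ∘ f`. -/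
noncomputable def essentialObjective (φ : E → ℝ) (f : E → F) (Θ : Set F) (x : E) : EReal :=
  (φ x : EReal) + indicatorFun Θ (f x)

end Problem

end VarAnalysis

open VarAnalysis

/-! For a critical direction `w` the theorem is a convex duality statement. The primal problem
minimizes `⟨∇²φ w, w⟩ - ⟨v, a⟩` over the second-order tangents `a` to the feasible set at `w`; the
dual problem maximizes `secondOrderForm` over the multipliers. Parabolic regularity identifies the
second subderivative of the indicator of `Θ` with the minimum of `-⟨lam, z⟩` over second-order
tangents `z` to `Θ`, so that `secondOrderForm` is the dual objective.

Weak duality is `secondOrderForm_le`. For strong duality, metric subregularity passes to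
second-order tangent sets (`LocalErrorBound.exists_mem_secondTangentSet`). This makes a norm penalty
exact, and Hahn-Banach then yields a multiplier (`exists_multiplier_of_exact_penalty`). Parabolic
derivability supplies convexity and nonemptiness of the second-order tangent set. Attainment of the
maximum follows at once (`LocalErrorBound.exists_isMaxOn_secondOrderForm`).

Expanding the objective along parabolic sequences shows that growth with constant `l` bounds the
primal value below by `l ‖w‖²`. The case `l = 0` is the necessary condition, and `l > 0` is one half
of the equivalence. The other half is a compactness argument
(`exists_growth_of_forall_secondOrderForm_pos`): normalized points violating growth converge to a
critical direction at which no multiplier gives a positive value. -/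

namespace VarAnalysis

/-! ### Second-order expansions under twice differentiability at a single point. -/

section Taylor

variable {E F : Type*} [NormedAddCommGroup E] [InnerProductSpace ℝ E]
  [NormedAddCommGroup F] [InnerProductSpace ℝ F]

/-- The derivative is differentiable only at `x`, so only the Peano form of the remainder is
available. It comes from the mean value inequality along the segment, where the derivative of the
remainder is at most `ε ‖h‖²`. -/
theorem TwiceDifferentiableAt.isLittleO {g : E → F} {x : E} (hg : TwiceDifferentiableAt g x) :
    (fun h => g (x + h) - g x - fderiv ℝ g x h - (1 / 2 : ℝ) • fderiv ℝ (fderiv ℝ g) x h h)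
      =o[𝓝 0] fun h => ‖h‖ ^ 2 := by
  obtain ⟨hd, hdd⟩ := hg
  refine Asymptotics.isLittleO_iff.2 fun ε hε => ?_
  have h1 := hdd.hasFDerivAt.isLittleO
  have h2 := (Asymptotics.isLittleO_iff.1 h1) hε
  obtain ⟨δ, hδ, hball⟩ := Metric.eventually_nhds_iff_ball.1 (hd.and h2)
  refine Metric.eventually_nhds_iff_ball.2 ⟨δ, hδ, fun h hh => ?_⟩
  have hh' : ‖h‖ < δ := by simpa using hh
  have hmem : ∀ s ∈ Set.Icc (0 : ℝ) 1, x + s • h ∈ Metric.ball x δ := by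
    intro s hs
    simp only [Metric.mem_ball, dist_self_add_left, norm_smul, Real.norm_eq_abs,
      abs_of_nonneg hs.1]
    nlinarith [norm_nonneg h, hs.2]
  have hder : ∀ s ∈ Set.Icc (0 : ℝ) 1, HasDerivWithinAt
      (fun s : ℝ => g (x + s • h) - s • fderiv ℝ g x h
        - (s ^ 2 / 2) • fderiv ℝ (fderiv ℝ g) x h h)
      (fderiv ℝ g (x + s • h) h - fderiv ℝ g x h - s • fderiv ℝ (fderiv ℝ g) x h h)
      (Set.Icc 0 1) s := by
    intro s hs
    have e1 : HasDerivAt (fun s : ℝ => x + s • h) h s := by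
      simpa using ((hasDerivAt_id s).smul_const h).const_add x
    have e2 := (hball _ (hmem s hs)).1.hasFDerivAt.comp_hasDerivAt s e1
    have e3 : HasDerivAt (fun s : ℝ => s • fderiv ℝ g x h) (fderiv ℝ g x h) s := by
      simpa using (hasDerivAt_id s).smul_const (fderiv ℝ g x h)
    have e4 : HasDerivAt (fun s : ℝ => (s ^ 2 / 2) • fderiv ℝ (fderiv ℝ g) x h h)
        (s • fderiv ℝ (fderiv ℝ g) x h h) s := by
      have : HasDerivAt (fun s : ℝ => s ^ 2 / 2) s s := by
        simpa using ((hasDerivAt_id s).pow 2).div_const 2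
      exact this.smul_const _
    exact ((e2.sub e3).sub e4).hasDerivWithinAt
  have hbound : ∀ s ∈ Set.Ico (0 : ℝ) 1,
      ‖fderiv ℝ g (x + s • h) h - fderiv ℝ g x h - s • fderiv ℝ (fderiv ℝ g) x h h‖
        ≤ ε * ‖h‖ ^ 2 := by
    intro s hs
    have hs' : s ∈ Set.Icc (0 : ℝ) 1 := ⟨hs.1, hs.2.le⟩
    have e := (hball _ (hmem s hs')).2
    rw [add_sub_cancel_left] at e
    have e5 := ContinuousLinearMap.le_of_opNorm_le _ e h
    simp only [sub_apply, map_smul, smul_apply] at e5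
    refine e5.trans ?_
    rw [norm_smul, Real.norm_eq_abs, abs_of_nonneg hs.1]
    have : s * ‖h‖ ≤ ‖h‖ := by nlinarith [norm_nonneg h, hs.2]
    calc ε * (s * ‖h‖) * ‖h‖ ≤ ε * ‖h‖ * ‖h‖ := by gcongr
      _ = ε * ‖h‖ ^ 2 := by ring
  have key := norm_image_sub_le_of_norm_deriv_le_segment_01' hder hbound
  simp only [one_smul, zero_smul, add_zero, sub_zero, one_pow] at key
  simp only [ne_eq, OfNat.ofNat_ne_zero, not_false_eq_true, zero_pow, zero_div, zero_smul,
    sub_zero] at key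
  rw [norm_pow, norm_norm]
  refine le_trans (le_of_eq ?_) key
  congr 1
  abel

theorem TwiceDifferentiableAt.tendsto_quotient {ι : Type*} {l : Filter ι} {g : E → F} {x w : E}
    (hg : TwiceDifferentiableAt g x) {t : ι → ℝ} {u : ι → E} (ht : Tendsto t l (𝓝[>] 0))
    (hu : Tendsto u l (𝓝 w)) :
    Tendsto (fun k => (t k ^ 2 / 2)⁻¹ • (g (x + t k • u k) - g x - t k • fderiv ℝ g x (u k))) l
      (𝓝 (fderiv ℝ (fderiv ℝ g) x w w)) := by
  have ht0 : Tendsto t l (𝓝 0) := ht.mono_right nhdsWithin_le_nhds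
  have htpos : ∀ᶠ k in l, 0 < t k := ht.eventually self_mem_nhdsWithin
  have htu : Tendsto (fun k => t k • u k) l (𝓝 0) := by simpa using ht0.smul hu
  have h1 := hg.isLittleO.comp_tendsto htu
  have h2 : (fun k => ‖t k • u k‖ ^ 2) =O[l] fun k => t k ^ 2 / 2 := by
    have : (fun k => t k ^ 2 / 2 * (2 * ‖u k‖ ^ 2)) =O[l] fun k => t k ^ 2 / 2 * (1 : ℝ) :=
      (Asymptotics.isBigO_refl _ _).mul (((hu.norm.pow 2).const_mul 2).isBigO_one ℝ)
    refine (this.congr (fun k => ?_) (fun k => by ring))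
    rw [norm_smul, Real.norm_eq_abs, mul_pow, sq_abs]; ring
  have h3 := (h1.trans_isBigO h2).tendsto_inv_smul_nhds_zero
  have h4 : Tendsto (fun k => fderiv ℝ (fderiv ℝ g) x (u k) (u k)) l
      (𝓝 (fderiv ℝ (fderiv ℝ g) x w w)) :=
    have : Continuous fun v => fderiv ℝ (fderiv ℝ g) x v v := by fun_prop
    (this.tendsto w).comp hu
  have h5 := h3.add h4
  rw [zero_add] at h5
  refine h5.congr' ?_
  filter_upwards [htpos] with k hk
  have hk' : t k ^ 2 / 2 ≠ 0 := by positivity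
  simp only [Function.comp, map_smul, smul_apply]
  rw [smul_sub, smul_smul, smul_smul, smul_smul]
  rw [show (t k ^ 2 / 2)⁻¹ * (1 / 2) * t k * t k = 1 by field_simp]
  simp

/-- The parabola is the ray `x + t (w + (t/2) u)` with a varying direction; the perturbation `(t/2)
u` contributes the first-order term in `z`. -/
theorem TwiceDifferentiableAt.tendsto_parabolic {ι : Type*} {l : Filter ι} {g : E → F} {x w z : E}
    (hg : TwiceDifferentiableAt g x) {t : ι → ℝ} {u : ι → E} (ht : Tendsto t l (𝓝[>] 0))
    (hu : Tendsto u l (𝓝 z)) :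
    Tendsto (fun k => (t k ^ 2 / 2)⁻¹ •
      (g (x + t k • w + (t k ^ 2 / 2) • u k) - g x - t k • fderiv ℝ g x w)) l
      (𝓝 (fderiv ℝ g x z + fderiv ℝ (fderiv ℝ g) x w w)) := by
  have ht0 : Tendsto t l (𝓝 0) := ht.mono_right nhdsWithin_le_nhds
  have htpos : ∀ᶠ k in l, 0 < t k := ht.eventually self_mem_nhdsWithin
  have hw : Tendsto (fun k => w + (t k / 2) • u k) l (𝓝 w) := by
    simpa using tendsto_const_nhds.add ((ht0.div_const 2).smul hu)
  have h1 := (((fderiv ℝ g x).continuous.tendsto z).comp hu).add (hg.tendsto_quotient ht hw)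
  refine h1.congr' ?_
  filter_upwards [htpos] with k hk
  have hk' : t k ^ 2 / 2 ≠ 0 := by positivity
  have e : x + t k • (w + (t k / 2) • u k) = x + t k • w + (t k ^ 2 / 2) • u k := by
    rw [smul_add, smul_smul, add_assoc]; ring_nf
  rw [e, map_add, map_smul, smul_add, smul_smul, ← sub_sub,
    show t k * (t k / 2) = t k ^ 2 / 2 by ring, smul_sub _ _ ((t k ^ 2 / 2) • _), smul_smul,
    inv_mul_cancel₀ hk', one_smul]
  simp

theorem TwiceDifferentiableAt.fderiv_fderiv_lagrangian {φ : E → ℝ} {f : E → F} {x : E}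
    (hφ : TwiceDifferentiableAt φ x) (hf : TwiceDifferentiableAt f x) (lam : F) (w : E) :
    fderiv ℝ (fderiv ℝ (fun z => lagrangian φ f z lam)) x w w =
      fderiv ℝ (fderiv ℝ φ) x w w + inner ℝ lam (fderiv ℝ (fderiv ℝ f) x w w) := by
  have h1 : fderiv ℝ (fun z => lagrangian φ f z lam) =ᶠ[𝓝 x]
      fun z => fderiv ℝ φ z + (innerSL ℝ lam).comp (fderiv ℝ f z) := by
    filter_upwards [hφ.1, hf.1] with z hz hz'
    exact (hz.hasFDerivAt.add ((innerSL ℝ lam).hasFDerivAt.comp z hz'.hasFDerivAt)).fderiv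
  have h2 : HasFDerivAt (fun z => fderiv ℝ φ z + (innerSL ℝ lam).comp (fderiv ℝ f z))
      (fderiv ℝ (fderiv ℝ φ) x + (ContinuousLinearMap.compL ℝ E F ℝ (innerSL ℝ lam)).comp
        (fderiv ℝ (fderiv ℝ f) x)) x :=
    hφ.2.hasFDerivAt.add
      ((ContinuousLinearMap.compL ℝ E F ℝ (innerSL ℝ lam)).hasFDerivAt.comp x hf.2.hasFDerivAt)
  rw [h1.fderiv_eq, h2.fderiv]
  simp

end Taylor

end VarAnalysis

namespace VarAnalysis

/-! ### Multipliers by separation, and normals to convex sets. -/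

section Duality

variable {E F : Type*} [NormedAddCommGroup E] [InnerProductSpace ℝ E]
  [NormedAddCommGroup F] [InnerProductSpace ℝ F]

/-- Lagrange duality for a linear objective under a convex constraint `A x + b ∈ C`
for which the norm penalty with weight `c` is exact. -/
theorem exists_multiplier_of_exact_penalty [CompleteSpace E] [CompleteSpace F] {C : Set F}
    (hC : Convex ℝ C) (hne : C.Nonempty) (A : E →L[ℝ] F) (b : F) (v : E) (p : ℝ) {c : ℝ}
    (hc : 0 ≤ c) (h : ∀ x, ∀ z ∈ C, p ≤ -inner ℝ v x + c * ‖A x + b - z‖) :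
    ∃ lam : F, ‖lam‖ ≤ c ∧ ContinuousLinearMap.adjoint A lam = v ∧
      ∀ z ∈ C, p ≤ inner ℝ lam (b - z) := by
  -- An open convex cone below the graph of the penalty is separated from the attainable pairs
  -- (residual, value minus `p`). Exactness of the penalty says precisely that the two sets are
  -- disjoint, and openness of the cone replaces any interior point condition on `C`.
  set C₁ : Set (F × ℝ) := {a | a.2 < -(c * ‖a.1‖)} with hC₁
  set C₂ : Set (F × ℝ) := {a | ∃ x, ∃ z ∈ C, a = (A x + b - z, -inner ℝ v x - p)} with hC₂
  have hconv₁ : Convex ℝ C₁ := by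
    rintro ⟨q₁, r₁⟩ h₁ ⟨q₂, r₂⟩ h₂ α β hα hβ hαβ
    simp only [hC₁, Set.mem_ofPred_eq, Prod.smul_mk, Prod.mk_add_mk, smul_eq_mul] at h₁ h₂ ⊢
    have h3 : ‖α • q₁ + β • q₂‖ ≤ α * ‖q₁‖ + β * ‖q₂‖ := by
      refine (norm_add_le _ _).trans (le_of_eq ?_)
      rw [norm_smul, norm_smul, Real.norm_of_nonneg hα, Real.norm_of_nonneg hβ]
    have h4 := mul_le_mul_of_nonneg_left h3 hc
    rcases hα.eq_or_lt with rfl | hα'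
    · have : β = 1 := by linarith
      subst this; simpa using h₂
    · nlinarith [mul_lt_mul_of_pos_left h₁ hα', mul_le_mul_of_nonneg_left h₂.le hβ]
  have hopen₁ : IsOpen C₁ := isOpen_lt (by fun_prop) (by fun_prop)
  have hconv₂ : Convex ℝ C₂ := by
    rintro _ ⟨x₁, z₁, h₁, rfl⟩ _ ⟨x₂, z₂, h₂, rfl⟩ α β hα hβ hαβ
    refine ⟨α • x₁ + β • x₂, α • z₁ + β • z₂, hC h₁ h₂ hα hβ hαβ, ?_⟩
    obtain rfl : α = 1 - β := by linarith
    ext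
    · simp only [Prod.smul_mk, Prod.mk_add_mk, map_add, map_smul]
      module
    · simp only [Prod.smul_mk, Prod.mk_add_mk, smul_eq_mul, inner_add_right, inner_smul_right]
      ring
  have hdisj : Disjoint C₁ C₂ := by
    refine Set.disjoint_left.2 ?_
    rintro _ ha ⟨x, z, hz, rfl⟩
    have := h x z hz
    simp only [hC₁, Set.mem_ofPred_eq] at ha
    linarith
  obtain ⟨g, s, hg₁, hg₂⟩ := geometric_hahn_banach_open hconv₁ hopen₁ hconv₂ hdisj
  set μ : F := (InnerProductSpace.toDual ℝ F).symm (g.comp (ContinuousLinearMap.inl ℝ F ℝ)) with hμ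
  set α : ℝ := g (0, 1) with hα
  have hg : ∀ q r, g (q, r) = inner ℝ μ q + α * r := by
    intro q r
    rw [hμ, InnerProductSpace.toDual_symm_apply, hα]
    have : (q, r) = (q, (0 : ℝ)) + r • ((0 : F), (1 : ℝ)) := by simp
    rw [this, map_add, map_smul, smul_eq_mul]
    simp [mul_comm]
  have hs : 0 ≤ s := by
    refine le_of_forall_pos_le_add fun ε hε => ?_
    by_contra! hlt
    have h1 : ∀ τ > 0, -(α * τ) < s := by
      intro τ hτ
      have := hg₁ (0, -τ) (by simpa [hC₁] using hτ)
      rw [hg] at this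
      simpa using this
    have hτ : 0 < ε / (|α| + 1) := by positivity
    have h2 := h1 _ hτ
    have h3 : α * (ε / (|α| + 1)) ≤ ε := by
      rw [mul_div_assoc', div_le_iff₀ (by positivity)]
      nlinarith [le_abs_self α]
    linarith
  have hneg : ∀ q r, r < -(c * ‖q‖) → inner ℝ μ q + α * r ≤ 0 := by
    intro q r hr
    by_contra! hpos
    set d := inner ℝ μ q + α * r
    have hτ : 0 < (s + 1) / d := by positivity
    -- `C₁` is a cone: a positive value `d` of `g` could be scaled up to `s + 1`, beyond the bound
    -- `s`.
    have h1 := hg₁ (((s + 1) / d) • q, (s + 1) / d * r) (by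
      simp only [hC₁, Set.mem_ofPred_eq, norm_smul, Real.norm_of_nonneg hτ.le]
      nlinarith [mul_lt_mul_of_pos_left hr hτ])
    rw [hg, inner_smul_right, show (s + 1) / d * inner ℝ μ q + α * ((s + 1) / d * r)
      = (s + 1) / d * d by ring, div_mul_cancel₀ _ hpos.ne'] at h1
    linarith
  have hαpos : 0 < α := by
    have h0 : 0 ≤ α := by
      have := hneg 0 (-1) (by simp)
      simp at this; exact this
    refine h0.lt_of_ne fun h0 => ?_
    -- A vertical hyperplane is impossible: `α = 0` forces `μ = 0`, and then `g = 0` contradicts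
    -- strict separation.
    have h1 := hneg μ (-(c * ‖μ‖) - 1) (by linarith)
    rw [← h0, zero_mul, add_zero, real_inner_self_eq_norm_sq] at h1
    have hμ0 : μ = 0 := by
      rw [← norm_eq_zero]; nlinarith [norm_nonneg μ]
    obtain ⟨z, hz⟩ := hne
    have h2 := hg₂ _ ⟨0, z, hz, rfl⟩
    have h3 := hg₁ (0, -1) (by simp [hC₁])
    rw [hg, ← h0, hμ0] at h2 h3
    simp at h2 h3
    linarith
  have hmain : ∀ x, ∀ z ∈ C, p ≤ -inner ℝ v x + inner ℝ (α⁻¹ • μ) (A x + b - z) := by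
    intro x z hz
    have h1 := hg₂ _ ⟨x, z, hz, rfl⟩
    rw [hg] at h1
    rw [inner_smul_left]
    simp only [map_inv₀, conj_trivial]
    have h2 : 0 ≤ α⁻¹ * (inner ℝ μ (A x + b - z) + α * (-inner ℝ v x - p)) :=
      mul_nonneg (inv_nonneg.2 hαpos.le) (hs.trans h1)
    rw [mul_add, inv_mul_cancel_left₀ hαpos.ne'] at h2
    linarith
  have hadj : ContinuousLinearMap.adjoint A (α⁻¹ • μ) = v := by
    obtain ⟨z, hz⟩ := hne
    set lam := α⁻¹ • μ
    set y := ContinuousLinearMap.adjoint A lam - v with hy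
    -- An affine function of `x` bounded below has zero slope; the slope `y` is tested along its own
    -- line.
    have h1 : ∀ τ : ℝ, p ≤ -(τ * ‖y‖ ^ 2) + inner ℝ lam (b - z) := by
      intro τ
      refine (hmain (-τ • y) z hz).trans (le_of_eq ?_)
      rw [add_sub_assoc, inner_add_right, ← ContinuousLinearMap.adjoint_inner_left,
        ← real_inner_self_eq_norm_sq]
      nth_rewrite 3 [hy]
      rw [inner_sub_left]
      simp only [inner_smul_right]
      ring
    rw [← sub_eq_zero, ← hy, ← norm_eq_zero]
    by_contra hne
    have hpos : 0 < ‖y‖ ^ 2 := by positivity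
    have h2 := h1 ((inner ℝ lam (b - z) - p + 1) / ‖y‖ ^ 2)
    rw [div_mul_cancel₀ _ hpos.ne'] at h2
    linarith
  refine ⟨α⁻¹ • μ, ?_, hadj, fun z hz => by simpa using hmain 0 z hz⟩
  rw [norm_smul, norm_inv, Real.norm_of_nonneg hαpos.le, inv_mul_le_iff₀ hαpos]
  rcases (norm_nonneg μ).eq_or_lt with h0 | h0
  · rw [← h0]; positivity
  refine le_of_mul_le_mul_right ?_ h0
  refine le_of_forall_pos_le_add fun ε hε => ?_
  -- Testing just below the graph of the penalty at `μ` itself gives `‖μ‖ ≤ α c`.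
  have h1 := hneg μ (-(c * ‖μ‖) - ε / α) (by linarith [div_pos hε hαpos])
  rw [real_inner_self_eq_norm_sq, mul_sub, mul_div_cancel₀ _ hαpos.ne'] at h1
  linarith

theorem mem_limitingNormalCone_of_forall_inner_nonpos {Θ : Set F} {y lam : F} (hy : y ∈ Θ)
    (h : ∀ θ ∈ Θ, inner ℝ lam (θ - y) ≤ 0) : lam ∈ limitingNormalCone Θ y := by
  refine ⟨fun _ => y, fun _ => lam, fun _ => hy, tendsto_const_nhds, tendsto_const_nhds,
    fun _ ε hε => ?_⟩
  filter_upwards [self_mem_nhdsWithin] with θ hθ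
  exact (h θ hθ).trans (by positivity)

/-- The segment from `y` to `θ` stays in `Θ`, and both sides of the regular normal inequality scale
linearly along it. -/
theorem inner_nonpos_of_mem_regularNormalCone {Θ : Set F} (hΘ : Convex ℝ Θ) {y lam : F}
    (hy : y ∈ Θ) (h : lam ∈ regularNormalCone Θ y) {θ : F} (hθ : θ ∈ Θ) :
    inner ℝ lam (θ - y) ≤ 0 := by
  refine le_of_forall_pos_le_add fun ε hε => ?_
  rw [zero_add]
  have hcurve : Tendsto (fun t : ℝ => y + t • (θ - y)) (𝓝[>] 0) (𝓝[Θ] y) := by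
    refine tendsto_nhdsWithin_iff.2 ⟨?_, ?_⟩
    · have : Continuous fun t : ℝ => y + t • (θ - y) := by fun_prop
      simpa using (this.tendsto 0).mono_left nhdsWithin_le_nhds
    · filter_upwards [Ioc_mem_nhdsGT (zero_lt_one' ℝ)] with t ht
      exact hΘ.add_smul_sub_mem hy hθ ⟨ht.1.le, ht.2⟩
  have hε' : 0 < ε / (‖θ - y‖ + 1) := by positivity
  obtain ⟨t, ht, htpos⟩ := ((hcurve.eventually (h _ hε')).and self_mem_nhdsWithin).exists
  have htpos : 0 < t := htpos
  rw [add_sub_cancel_left, inner_smul_right, norm_smul, Real.norm_of_nonneg htpos.le] at ht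
  have h1 : inner ℝ lam (θ - y) ≤ ε / (‖θ - y‖ + 1) * ‖θ - y‖ := by
    refine le_of_mul_le_mul_left ?_ htpos
    linarith
  refine h1.trans ?_
  rw [div_mul_eq_mul_div, div_le_iff₀ (by positivity)]
  nlinarith [norm_nonneg (θ - y)]

theorem mem_limitingNormalCone_iff_of_convex {Θ : Set F} (hΘ : Convex ℝ Θ) {y lam : F}
    (hy : y ∈ Θ) :
    lam ∈ limitingNormalCone Θ y ↔ ∀ θ ∈ Θ, inner ℝ lam (θ - y) ≤ 0 := by
  refine ⟨?_, mem_limitingNormalCone_of_forall_inner_nonpos hy⟩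
  rintro ⟨x', v', hx', hxlim, hvlim, hreg⟩ θ hθ
  refine le_of_tendsto' (hvlim.inner (tendsto_const_nhds.sub hxlim)) fun k => ?_
  exact inner_nonpos_of_mem_regularNormalCone hΘ (hx' k) (hreg k) hθ

end Duality

end VarAnalysis

namespace VarAnalysis

/-! ### Metric subregularity as an error bound with approximate projections. -/

section ErrorBound

variable {E F : Type*} [NormedAddCommGroup E] [NormedAddCommGroup F]

/-- Near `x`, the distance to the feasible set is at most `κ` times the constraint residual. -/
def LocalErrorBound (f : E → F) (Θ : Set F) (x : E) (κ : ℝ) : Prop :=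
  ∀ᶠ z in 𝓝 x, ∀ θ ∈ Θ, ∀ ε > 0, ∃ z', f z' ∈ Θ ∧ ‖z' - z‖ < κ * ‖f z - θ‖ + ε

theorem MSCQ.localErrorBound {f : E → F} {Θ : Set F} {x : E} {κ : ℝ} (hκ : 0 < κ)
    (h : MSCQ f Θ x κ) : LocalErrorBound f Θ x κ := by
  filter_upwards [h.2] with z hz θ hθ ε hε
  have h1 : Metric.infEDist (0 : F) ((fun θ => f z - θ) '' Θ) ≤ ENNReal.ofReal ‖f z - θ‖ := by
    refine (Metric.infEDist_le_edist_of_mem (Set.mem_image_of_mem _ hθ)).trans ?_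
    rw [edist_dist, dist_zero_left]
  have h2 : Metric.infEDist z {z' | (0 : F) ∈ (fun θ => f z' - θ) '' Θ} <
      ENNReal.ofReal (κ * ‖f z - θ‖ + ε) := by
    refine (hz.trans (mul_le_mul_right h1 _)).trans_lt ?_
    rw [← ENNReal.ofReal_mul hκ.le]
    exact (ENNReal.ofReal_lt_ofReal_iff (by positivity)).2 (by linarith)
  obtain ⟨z', ⟨θ', hθ', he⟩, hlt⟩ := Metric.infEDist_lt_iff.1 h2
  refine ⟨z', ?_, ?_⟩
  · rw [sub_eq_zero.1 he]; exact hθ'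
  · rw [edist_dist, ENNReal.ofReal_lt_ofReal_iff (by positivity), dist_comm, dist_eq_norm] at hlt
    exact hlt

end ErrorBound

/-! ### Feasible corrections and existence of multipliers. -/

section Subregularity

variable {E F : Type*} [NormedAddCommGroup E] [InnerProductSpace ℝ E]
  [NormedAddCommGroup F] [InnerProductSpace ℝ F]

/-- A residual of order `s` is repaired by a displacement of order `s`; the rescaled displacements
are bounded, hence converge along a subsequence. It serves with `s = t` for first-order and `s =
t²/2` for second-order tangents. -/
theorem LocalErrorBound.exists_feasible_correction [FiniteDimensional ℝ E] {f : E → F}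
    {Θ : Set F} {x : E} {κ : ℝ} (h : LocalErrorBound f Θ x κ) {s : ℕ → ℝ} {p : ℕ → E}
    {θ : ℕ → F} {r : F} (hs : Tendsto s atTop (𝓝[>] 0)) (hp : Tendsto p atTop (𝓝 x))
    (hθ : ∀ k, θ k ∈ Θ) (hr : Tendsto (fun k => (s k)⁻¹ • (f (p k) - θ k)) atTop (𝓝 r)) :
    ∃ (ψ : ℕ → ℕ) (u : ℕ → E) (u₀ : E), StrictMono ψ ∧ Tendsto u atTop (𝓝 u₀) ∧
      ‖u₀‖ ≤ κ * ‖r‖ ∧ ∀ k, f (p (ψ k) + s (ψ k) • u k) ∈ Θ := by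
  have hs0 : Tendsto s atTop (𝓝 0) := hs.mono_right nhdsWithin_le_nhds
  have hspos : ∀ᶠ k in atTop, 0 < s k := hs.eventually self_mem_nhdsWithin
  obtain ⟨N, hN⟩ := eventually_atTop.1 ((hp.eventually h).and hspos)
  have hex : ∀ k, ∃ u : E, f (p (k + N) + s (k + N) • u) ∈ Θ ∧
      ‖u‖ ≤ κ * ‖(s (k + N))⁻¹ • (f (p (k + N)) - θ (k + N))‖ + s (k + N) := by
    intro k
    obtain ⟨h1, h2⟩ := hN (k + N) (by omega)
    -- The slack `s²` still vanishes after division by `s`.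
    obtain ⟨z', hz', hlt⟩ := h1 _ (hθ (k + N)) (s (k + N) ^ 2) (by positivity)
    refine ⟨(s (k + N))⁻¹ • (z' - p (k + N)), ?_, ?_⟩
    · rw [smul_inv_smul₀ h2.ne', add_sub_cancel]; exact hz'
    · rw [norm_smul, norm_smul, norm_inv, Real.norm_of_nonneg h2.le, inv_mul_le_iff₀ h2]
      refine hlt.le.trans (le_of_eq ?_)
      field_simp
  choose u hu hub using hex
  have hlim : Tendsto (fun k => κ * ‖(s (k + N))⁻¹ • (f (p (k + N)) - θ (k + N))‖ + s (k + N))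
      atTop (𝓝 (κ * ‖r‖)) := by
    have := ((hr.norm.const_mul κ).add hs0).comp (tendsto_add_atTop_nat N)
    rwa [add_zero] at this
  obtain ⟨R, hR⟩ := hlim.bddAbove_range
  have hbdd : ∀ k, u k ∈ Metric.closedBall (0 : E) R := fun k => by
    rw [mem_closedBall_zero_iff]
    exact (hub k).trans (hR ⟨k, rfl⟩)
  obtain ⟨u₀, -, ψ, hψ, hψlim⟩ := tendsto_subseq_of_bounded Metric.isBounded_closedBall hbdd
  refine ⟨fun k => ψ k + N, u ∘ ψ, u₀, hψ.add_const N, hψlim, ?_, fun k => hu (ψ k)⟩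
  exact le_of_tendsto_of_tendsto' hψlim.norm (hlim.comp hψ.tendsto_atTop) fun k => hub (ψ k)

theorem tendsto_one_div_add_one_nhdsGT :
    Tendsto (fun k : ℕ => 1 / ((k : ℝ) + 1)) atTop (𝓝[>] 0) :=
  tendsto_nhdsWithin_iff.2 ⟨tendsto_one_div_add_atTop_nhds_zero_nat,
    Eventually.of_forall fun k => Set.mem_Ioi.2 (Nat.one_div_pos_of_nat (n := k))⟩

theorem tendsto_quotient_of_hasFDerivAt {ι : Type*} {l : Filter ι} {f : E → F} {A : E →L[ℝ] F}
    {x w : E} (hf : HasFDerivAt f A x) {t : ι → ℝ} {u : ι → E} (ht : Tendsto t l (𝓝[>] 0))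
    (hu : Tendsto u l (𝓝 w)) :
    Tendsto (fun k => (t k)⁻¹ • (f (x + t k • u k) - f x)) l (𝓝 (A w)) := by
  have ht0 : Tendsto t l (𝓝 0) := ht.mono_right nhdsWithin_le_nhds
  have htpos : ∀ᶠ k in l, 0 < t k := ht.eventually self_mem_nhdsWithin
  have htu : Tendsto (fun k => t k • u k) l (𝓝 0) := by simpa using ht0.smul hu
  refine (hasFDerivWithinAt_univ.2 hf).lim htu (Eventually.of_forall fun _ => Set.mem_univ _) ?_
  refine hu.congr' ?_
  filter_upwards [htpos] with k hk
  rw [inv_smul_smul₀ hk.ne']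

/-- Exactness of the norm penalty for the linearized system: correcting `x + t w` toward the segment
from `f x` to `θ` gives a tangent direction `w + u₀`, on which `v` is nonpositive, with `‖u₀‖`
controlled by the linearized residual. -/
theorem LocalErrorBound.inner_le_of_mem_regularNormalCone [FiniteDimensional ℝ E] {f : E → F}
    {Θ : Set F} {x : E} {κ : ℝ} (h : LocalErrorBound f Θ x κ) (hΘ : Convex ℝ Θ) (hx : f x ∈ Θ)
    (hf : DifferentiableAt ℝ f x) {v : E} (hv : v ∈ regularNormalCone {z | f z ∈ Θ} x) (w : E)
    {θ : F} (hθ : θ ∈ Θ) :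
    inner ℝ v w ≤ κ * ‖v‖ * ‖fderiv ℝ f x w - (θ - f x)‖ := by
  set t : ℕ → ℝ := fun k => 1 / ((k : ℝ) + 1) with ht_def
  have ht : Tendsto t atTop (𝓝[>] 0) := tendsto_one_div_add_one_nhdsGT
  have ht0 : Tendsto t atTop (𝓝 0) := ht.mono_right nhdsWithin_le_nhds
  have htpos : ∀ k, 0 < t k := fun k => Nat.one_div_pos_of_nat
  have ht1 : ∀ k, t k ≤ 1 := fun k => by
    rw [ht_def]; exact (div_le_one (by positivity)).2 (by simp)
  have hp : Tendsto (fun k => x + t k • w) atTop (𝓝 x) := by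
    simpa using tendsto_const_nhds.add (ht0.smul_const w)
  have hr : Tendsto (fun k => (t k)⁻¹ • (f (x + t k • w) - (f x + t k • (θ - f x)))) atTop
      (𝓝 (fderiv ℝ f x w - (θ - f x))) := by
    refine ((tendsto_quotient_of_hasFDerivAt hf.hasFDerivAt ht
      tendsto_const_nhds).sub_const (θ - f x)).congr fun k => ?_
    rw [← sub_sub, smul_sub _ (_ - f x), inv_smul_smul₀ (htpos k).ne']
  obtain ⟨ψ, u, u₀, hψ, hu, hub, hmem⟩ := h.exists_feasible_correction ht hp
    (fun k => hΘ.add_smul_sub_mem hx hθ ⟨(htpos k).le, ht1 k⟩) hr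
  have htψ : Tendsto (fun k => t (ψ k)) atTop (𝓝 0) := ht0.comp hψ.tendsto_atTop
  have hwu : Tendsto (fun k => w + u k) atTop (𝓝 (w + u₀)) := tendsto_const_nhds.add hu
  have hcurve : Tendsto (fun k => x + t (ψ k) • (w + u k)) atTop (𝓝[{z | f z ∈ Θ}] x) := by
    refine tendsto_nhdsWithin_iff.2 ⟨?_, Eventually.of_forall fun k => ?_⟩
    · simpa using tendsto_const_nhds.add (htψ.smul hwu)
    · have := hmem k
      rwa [add_assoc, ← smul_add] at this
  have key : inner ℝ v (w + u₀) ≤ 0 := by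
    have h1 : ∀ ε > 0, inner ℝ v (w + u₀) ≤ ε * ‖w + u₀‖ := by
      intro ε hε
      refine le_of_tendsto_of_tendsto (tendsto_const_nhds.inner hwu) (hwu.norm.const_mul ε) ?_
      filter_upwards [hcurve.eventually (hv ε hε)] with k hk
      rw [add_sub_cancel_left, inner_smul_right, norm_smul, Real.norm_of_nonneg (htpos _).le] at hk
      refine le_of_mul_le_mul_left ?_ (htpos (ψ k))
      linarith
    refine le_of_forall_pos_le_add fun ε hε => ?_
    refine (h1 (ε / (‖w + u₀‖ + 1)) (by positivity)).trans ?_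
    rw [zero_add, div_mul_eq_mul_div, div_le_iff₀ (by positivity)]
    nlinarith [norm_nonneg (w + u₀)]
  rw [inner_add_right] at key
  have h2 : -inner ℝ v u₀ ≤ ‖v‖ * ‖u₀‖ :=
    (neg_le_abs _).trans (abs_real_inner_le_norm _ _)
  have h3 := mul_le_mul_of_nonneg_left hub (norm_nonneg v)
  linarith

theorem LocalErrorBound.exists_multiplier [FiniteDimensional ℝ E] [CompleteSpace E]
    [CompleteSpace F] {f : E → F} {Θ : Set F} {x : E} {κ : ℝ} (h : LocalErrorBound f Θ x κ)
    (hκ : 0 ≤ κ) (hΘ : Convex ℝ Θ) (hx : f x ∈ Θ) (hf : DifferentiableAt ℝ f x) {v : E}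
    (hv : v ∈ regularNormalCone {z | f z ∈ Θ} x) :
    ∃ lam : F, ‖lam‖ ≤ κ * ‖v‖ ∧ ContinuousLinearMap.adjoint (fderiv ℝ f x) lam = v ∧
      ∀ θ ∈ Θ, inner ℝ lam (θ - f x) ≤ 0 := by
  obtain ⟨lam, h1, h2, h3⟩ := exists_multiplier_of_exact_penalty hΘ ⟨_, hx⟩ (fderiv ℝ f x) (f x)
    v 0 (mul_nonneg hκ (norm_nonneg v)) fun w θ hθ => by
      have := h.inner_le_of_mem_regularNormalCone hΘ hx hf hv w hθ
      rw [sub_sub_eq_add_sub] at this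
      linarith
  refine ⟨lam, h1, h2, fun θ hθ => ?_⟩
  have := h3 θ hθ
  rw [← neg_sub, inner_neg_right] at this
  linarith

/-- The error bound holds at nearby points with the same `κ`, so the multipliers of the
approximating regular normals are uniformly bounded and have a cluster point. -/
theorem LocalErrorBound.lagrangeMultipliers_nonempty [FiniteDimensional ℝ E]
    [FiniteDimensional ℝ F] [CompleteSpace E] [CompleteSpace F] {f : E → F} {Θ : Set F} {x : E}
    {κ : ℝ} (h : LocalErrorBound f Θ x κ) (hκ : 0 ≤ κ) (hΘ : Convex ℝ Θ) (hx : f x ∈ Θ)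
    (hf : TwiceDifferentiableAt f x) {v : E} (hv : v ∈ limitingNormalCone {z | f z ∈ Θ} x) :
    (lagrangeMultipliers f Θ x v).Nonempty := by
  obtain ⟨x', v', hx', hxlim, hvlim, hreg⟩ := hv
  have hnear : ∀ᶠ z in 𝓝 x, LocalErrorBound f Θ z κ := eventually_eventually_nhds.2 h
  obtain ⟨N, hN⟩ := eventually_atTop.1 (hxlim.eventually (hnear.and hf.1))
  have hex : ∀ k, ∃ lam : F, ‖lam‖ ≤ κ * ‖v' (k + N)‖ ∧
      ContinuousLinearMap.adjoint (fderiv ℝ f (x' (k + N))) lam = v' (k + N) ∧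
      ∀ θ ∈ Θ, inner ℝ lam (θ - f (x' (k + N))) ≤ 0 := fun k =>
    (hN (k + N) (by omega)).1.exists_multiplier hκ hΘ (hx' _) (hN (k + N) (by omega)).2 (hreg _)
  choose lam hlam₁ hlam₂ hlam₃ using hex
  have hxN := hxlim.comp (tendsto_add_atTop_nat N)
  have hvN := hvlim.comp (tendsto_add_atTop_nat N)
  obtain ⟨R, hR⟩ := (hvN.norm.const_mul κ).bddAbove_range
  have hbdd : ∀ k, lam k ∈ Metric.closedBall (0 : F) R := fun k => by
    rw [mem_closedBall_zero_iff]
    exact (hlam₁ k).trans (hR ⟨k, rfl⟩)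
  obtain ⟨lam₀, -, ψ, hψ, hlim⟩ := tendsto_subseq_of_bounded Metric.isBounded_closedBall hbdd
  have hxψ := hxN.comp hψ.tendsto_atTop
  have hvψ := hvN.comp hψ.tendsto_atTop
  refine ⟨lam₀, (mem_limitingNormalCone_iff_of_convex hΘ hx).2 fun θ hθ => ?_, ?_⟩
  · have hfx : Tendsto (fun k => θ - f (x' (ψ k + N))) atTop (𝓝 (θ - f x)) :=
      tendsto_const_nhds.sub ((hf.1.self_of_nhds.continuousAt.tendsto).comp hxψ)
    exact le_of_tendsto' (hlim.inner hfx) fun k => hlam₃ (ψ k) θ hθ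
  · refine ext_inner_right ℝ fun w => ?_
    rw [ContinuousLinearMap.adjoint_inner_left]
    have hA : Tendsto (fun k => fderiv ℝ f (x' (ψ k + N)) w) atTop (𝓝 (fderiv ℝ f x w)) :=
      ((ContinuousLinearMap.apply ℝ F w).continuous.tendsto _).comp
        ((hf.2.continuousAt.tendsto).comp hxψ)
    refine tendsto_nhds_unique (hlim.inner hA) ((hvψ.inner tendsto_const_nhds).congr fun k => ?_)
    simp only [Function.comp_apply]
    rw [← hlam₂ (ψ k), ContinuousLinearMap.adjoint_inner_left]

end Subregularity

end VarAnalysis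

namespace VarAnalysis

/-! ### Second subderivatives of indicators and second-order tangent sets. -/

section SecondOrder

variable {F : Type*} [NormedAddCommGroup F] [InnerProductSpace ℝ F]

theorem secondQuotient_indicatorFun_of_mem {Θ : Set F} {y lam u : F} {t : ℝ} (hy : y ∈ Θ)
    (ht : 0 < t) (hu : y + t • u ∈ Θ) :
    secondQuotient (indicatorFun Θ) y lam t u = ((-(2 / t * inner ℝ lam u) : ℝ) : EReal) := by
  rw [secondQuotient, indicatorFun, indicatorFun, if_pos hu, if_pos hy, sub_zero, zero_sub,
    ← EReal.coe_neg, ← EReal.coe_div]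
  congr 1
  field_simp

theorem secondQuotient_indicatorFun_of_notMem {Θ : Set F} {y lam u : F} {t : ℝ} (hy : y ∈ Θ)
    (ht : 0 < t) (hu : y + t • u ∉ Θ) :
    secondQuotient (indicatorFun Θ) y lam t u = ⊤ := by
  rw [secondQuotient, indicatorFun, indicatorFun, if_neg hu, if_pos hy, sub_zero,
    EReal.top_sub_coe]
  exact EReal.top_div_of_pos_ne_top (by exact_mod_cast (by positivity)) (EReal.coe_ne_top _)

theorem secondSubderivative_le_liminf {ψ : F → EReal} {y v u : F} {t : ℕ → ℝ} {u' : ℕ → F}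
    (ht : Tendsto t atTop (𝓝[>] 0)) (hu : Tendsto u' atTop (𝓝 u)) :
    secondSubderivative ψ y v u ≤ liminf (fun k => secondQuotient ψ y v (t k) (u' k)) atTop :=
  liminf_le_liminf_of_le (u := fun p : ℝ × F => secondQuotient ψ y v p.1 p.2) (ht.prodMk hu)
    (by isBoundedDefault) (by isBoundedDefault)

/-- Along the directions `u + (t/2) z'` the difference quotient is exactly `-⟨lam, z'⟩`, because
`lam` annihilates `u`. -/
theorem secondSubderivative_indicatorFun_le {Θ : Set F} {y lam u z : F} (hy : y ∈ Θ)
    (hlam : inner ℝ lam u = 0) (hz : z ∈ secondTangentSet Θ y u) :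
    secondSubderivative (indicatorFun Θ) y lam u ≤ ((-inner ℝ lam z : ℝ) : EReal) := by
  obtain ⟨t, z', ht, hz', hmem⟩ := hz
  have ht0 : Tendsto t atTop (𝓝 0) := ht.mono_right nhdsWithin_le_nhds
  have htpos : ∀ᶠ k in atTop, 0 < t k := ht.eventually self_mem_nhdsWithin
  have hu : Tendsto (fun k => u + (t k / 2) • z' k) atTop (𝓝 u) := by
    simpa using tendsto_const_nhds.add ((ht0.div_const 2).smul hz')
  refine (secondSubderivative_le_liminf ht hu).trans (le_of_eq (Tendsto.liminf_eq ?_))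
  have h1 : Tendsto (fun k => ((-inner ℝ lam (z' k) : ℝ) : EReal)) atTop
      (𝓝 ((-inner ℝ lam z : ℝ) : EReal)) :=
    (continuous_coe_real_ereal.tendsto _).comp (tendsto_const_nhds.inner hz').neg
  refine h1.congr' ?_
  filter_upwards [htpos] with k hk
  have hm : y + t k • (u + (t k / 2) • z' k) ∈ Θ := by
    convert hmem k using 1
    rw [smul_add, smul_smul, add_assoc]; ring_nf
  rw [secondQuotient_indicatorFun_of_mem hy hk hm, inner_add_right, hlam, inner_smul_right]
  congr 2
  field_simp
  ring

/-- The rate bound keeps `2 (u' - u) / t` bounded, and its cluster points are second-order tangents.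
Together with the preceding inequality, the second subderivative is a minimum of `-⟨lam, z⟩` over
these tangents. -/
theorem ParabolicallyRegular.exists_secondSubderivative_eq [FiniteDimensional ℝ F] {Θ : Set F}
    {y lam u : F} (h : ParabolicallyRegular Θ y lam) (hy : y ∈ Θ) (hlam : inner ℝ lam u = 0)
    (hfin : secondSubderivative (indicatorFun Θ) y lam u < ⊤) :
    ∃ z ∈ secondTangentSet Θ y u,
      secondSubderivative (indicatorFun Θ) y lam u = ((-inner ℝ lam z : ℝ) : EReal) := by
  obtain ⟨t, u', ht, hu', hq, C, hC⟩ := h u hfin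
  have htpos : ∀ᶠ k in atTop, 0 < t k := ht.eventually self_mem_nhdsWithin
  have hlt := hq.eventually_lt_const hfin
  obtain ⟨N, hN⟩ := eventually_atTop.1 ((htpos.and hlt).and hC)
  have hpos : ∀ k, 0 < t (k + N) := fun k => (hN (k + N) (by omega)).1.1
  have hmem : ∀ k, y + t (k + N) • u' (k + N) ∈ Θ := fun k => by
    by_contra hnot
    have := (hN (k + N) (by omega)).1.2
    rw [secondQuotient_indicatorFun_of_notMem hy (hpos k) hnot] at this
    exact lt_irrefl _ this
  set z' : ℕ → F := fun k => (2 / t (k + N)) • (u' (k + N) - u) with hz'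
  have hbdd : ∀ k, z' k ∈ Metric.closedBall (0 : F) (2 * C) := fun k => by
    rw [mem_closedBall_zero_iff, hz', norm_smul,
      Real.norm_of_nonneg (div_nonneg zero_le_two (hpos k).le), div_mul_eq_mul_div, mul_div_assoc]
    exact mul_le_mul_of_nonneg_left (hN (k + N) (by omega)).2 zero_le_two
  obtain ⟨z, -, ψ, hψ, hlim⟩ := tendsto_subseq_of_bounded Metric.isBounded_closedBall hbdd
  have hσ : Tendsto (fun k => ψ k + N) atTop atTop :=
    (tendsto_add_atTop_nat N).comp hψ.tendsto_atTop
  refine ⟨z, ⟨fun k => t (ψ k + N), z' ∘ ψ, ht.comp hσ, hlim, fun k => ?_⟩, ?_⟩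
  · convert hmem (ψ k) using 1
    have := (hpos (ψ k)).ne'
    rw [Function.comp_apply, hz', smul_smul,
      show t (ψ k + N) ^ 2 / 2 * (2 / t (ψ k + N)) = t (ψ k + N) by field_simp]
    module
  · refine tendsto_nhds_unique (hq.comp hσ) ?_
    have h1 : Tendsto (fun k => ((-inner ℝ lam (z' (ψ k)) : ℝ) : EReal)) atTop
        (𝓝 ((-inner ℝ lam z : ℝ) : EReal)) :=
      (continuous_coe_real_ereal.tendsto _).comp (tendsto_const_nhds.inner hlim).neg
    refine h1.congr fun k => ?_
    rw [Function.comp_apply, secondQuotient_indicatorFun_of_mem hy (hpos _) (hmem _), hz',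
      inner_smul_right, inner_sub_right, hlam, sub_zero]

theorem ParabolicallyDerivable.exists_arc {Θ : Set F} {y u z : F}
    (h : ParabolicallyDerivable Θ y u) (hz : z ∈ secondTangentSet Θ y u) :
    ∃ z' : ℝ → F, Tendsto z' (𝓝[>] 0) (𝓝 z) ∧
      ∀ᶠ t in 𝓝[>] 0, y + t • u + (t ^ 2 / 2) • z' t ∈ Θ := by
  obtain ⟨ε, hε, ξ, hmem, h0, -, hlim⟩ := h.2 z hz
  refine ⟨_, hlim, ?_⟩
  filter_upwards [Ioc_mem_nhdsGT hε] with t ht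
  have ht0 : t ^ 2 / 2 ≠ 0 := by have := ht.1; positivity
  convert hmem t ⟨ht.1.le, ht.2⟩ using 1
  rw [smul_inv_smul₀ ht0, h0]
  module

theorem mem_secondTangentSet_of_eventually {Θ : Set F} {y u z : F} {t : ℕ → ℝ} {z' : ℕ → F}
    (ht : Tendsto t atTop (𝓝[>] 0)) (hz : Tendsto z' atTop (𝓝 z))
    (hmem : ∀ᶠ k in atTop, y + t k • u + (t k ^ 2 / 2) • z' k ∈ Θ) :
    z ∈ secondTangentSet Θ y u := by
  obtain ⟨N, hN⟩ := eventually_atTop.1 hmem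
  exact ⟨fun k => t (k + N), fun k => z' (k + N), ht.comp (tendsto_add_atTop_nat N),
    hz.comp (tendsto_add_atTop_nat N), fun k => hN (k + N) (by omega)⟩

/-- Two second-order tangents may come from unrelated step sequences; arcs defined for all small `t`
allow a common one, along which convexity of `Θ` applies. -/
theorem ParabolicallyDerivable.convex_secondTangentSet {Θ : Set F} {y u : F}
    (h : ParabolicallyDerivable Θ y u) (hΘ : Convex ℝ Θ) :
    Convex ℝ (secondTangentSet Θ y u) := by
  intro z₁ h₁ z₂ h₂ α β hα hβ hαβ
  obtain ⟨ζ₁, hlim₁, hmem₁⟩ := h.exists_arc h₁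
  obtain ⟨ζ₂, hlim₂, hmem₂⟩ := h.exists_arc h₂
  have ht := tendsto_one_div_add_one_nhdsGT
  refine mem_secondTangentSet_of_eventually ht
    (((hlim₁.comp ht).const_smul α).add ((hlim₂.comp ht).const_smul β)) ?_
  filter_upwards [ht.eventually hmem₁, ht.eventually hmem₂] with k hk₁ hk₂
  convert hΘ hk₁ hk₂ hα hβ hαβ using 1
  obtain rfl : α = 1 - β := by linarith
  simp only [Function.comp_apply]
  module

/-- Points of `Θ` are moved toward `θ` by the fraction `s t²/2`. Hence `θ - y` is a recession
direction, which later forces separating functionals to be normal to `Θ`. -/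
theorem add_smul_sub_mem_secondTangentSet {Θ : Set F} (hΘ : Convex ℝ Θ) {y u z θ : F}
    (hz : z ∈ secondTangentSet Θ y u) (hθ : θ ∈ Θ) {s : ℝ} (hs : 0 ≤ s) :
    z + s • (θ - y) ∈ secondTangentSet Θ y u := by
  obtain ⟨t, z', ht, hz', hmem⟩ := hz
  have ht0 : Tendsto t atTop (𝓝 0) := ht.mono_right nhdsWithin_le_nhds
  have hc : Tendsto (fun k => s * (t k ^ 2 / 2)) atTop (𝓝 0) := by
    simpa using ((ht0.pow 2).div_const 2).const_mul s
  have hd : Tendsto (fun k => t k • u + (t k ^ 2 / 2) • z' k) atTop (𝓝 0) := by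
    simpa using (ht0.smul_const u).add (((ht0.pow 2).div_const 2).smul hz')
  have hlim : Tendsto (fun k => z' k + s • (θ - y - (t k • u + (t k ^ 2 / 2) • z' k))) atTop
      (𝓝 (z + s • (θ - y))) := by
    simpa using hz'.add ((hd.const_sub (θ - y)).const_smul s)
  refine mem_secondTangentSet_of_eventually ht hlim ?_
  filter_upwards [hc.eventually_le_const one_pos] with k hk
  convert hΘ.add_smul_sub_mem (hmem k) hθ ⟨by positivity, hk⟩ using 1
  module

end SecondOrder

end VarAnalysis

namespace VarAnalysis

/-! ### Tangents of the feasible set against tangents of `Θ`. -/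

section ChainRules

variable {E F : Type*} [NormedAddCommGroup E] [InnerProductSpace ℝ E]
  [NormedAddCommGroup F] [InnerProductSpace ℝ F]

theorem inner_nonpos_of_mem_tangentCone {Θ : Set F} {y lam u : F}
    (hlam : ∀ θ ∈ Θ, inner ℝ lam (θ - y) ≤ 0) (hu : u ∈ tangentCone Θ y) :
    inner ℝ lam u ≤ 0 := by
  obtain ⟨t, u', ht, hu', hmem⟩ := hu
  have htpos : ∀ᶠ k in atTop, 0 < t k := ht.eventually self_mem_nhdsWithin
  refine le_of_tendsto (tendsto_const_nhds.inner hu') ?_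
  filter_upwards [htpos] with k hk
  have h1 := hlam _ (hmem k)
  rw [add_sub_cancel_left, inner_smul_right] at h1
  by_contra! hpos
  exact h1.not_gt (mul_pos hk hpos)

theorem fderiv_mem_tangentCone {f : E → F} {Θ : Set F} {x w : E} (hf : DifferentiableAt ℝ f x)
    (hw : w ∈ tangentCone {z | f z ∈ Θ} x) : fderiv ℝ f x w ∈ tangentCone Θ (f x) := by
  obtain ⟨t, w', ht, hw', hmem⟩ := hw
  have htpos : ∀ᶠ k in atTop, 0 < t k := ht.eventually self_mem_nhdsWithin
  have hlim := tendsto_quotient_of_hasFDerivAt hf.hasFDerivAt ht hw'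
  obtain ⟨N, hN⟩ := eventually_atTop.1 htpos
  refine ⟨fun k => t (k + N), _, ht.comp (tendsto_add_atTop_nat N),
    hlim.comp (tendsto_add_atTop_nat N), fun k => ?_⟩
  rw [Function.comp_apply, smul_inv_smul₀ (hN (k + N) (by omega)).ne', add_sub_cancel]
  exact hmem (k + N)

theorem fderiv_add_mem_secondTangentSet {f : E → F} {Θ : Set F} {x w a : E}
    (hf : TwiceDifferentiableAt f x) (ha : a ∈ secondTangentSet {z | f z ∈ Θ} x w) :
    fderiv ℝ f x a + fderiv ℝ (fderiv ℝ f) x w w ∈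
      secondTangentSet Θ (f x) (fderiv ℝ f x w) := by
  obtain ⟨t, a', ht, ha', hmem⟩ := ha
  have htpos : ∀ᶠ k in atTop, 0 < t k := ht.eventually self_mem_nhdsWithin
  refine mem_secondTangentSet_of_eventually ht (hf.tendsto_parabolic ht ha') ?_
  filter_upwards [htpos] with k hk
  have hk' : t k ^ 2 / 2 ≠ 0 := by positivity
  rw [smul_inv_smul₀ hk']
  convert hmem k using 1
  simp only [Set.mem_ofPred_eq]
  rw [show f x + t k • fderiv ℝ f x w + (f (x + t k • w + (t k ^ 2 / 2) • a' k) - f x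
    - t k • fderiv ℝ f x w) = f (x + t k • w + (t k ^ 2 / 2) • a' k) by abel]

/-- The error bound of the constraint system is inherited by its second-order tangent sets. -/
theorem LocalErrorBound.exists_mem_secondTangentSet [FiniteDimensional ℝ E] {f : E → F}
    {Θ : Set F} {x : E} {κ : ℝ} (h : LocalErrorBound f Θ x κ) (hf : TwiceDifferentiableAt f x)
    {w : E} {z : F} (hz : z ∈ secondTangentSet Θ (f x) (fderiv ℝ f x w)) (a : E) :
    ∃ a' ∈ secondTangentSet {z | f z ∈ Θ} x w,
      ‖a' - a‖ ≤ κ * ‖fderiv ℝ f x a + fderiv ℝ (fderiv ℝ f) x w w - z‖ := by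
  obtain ⟨t, z', ht, hz', hmem⟩ := hz
  have ht0 : Tendsto t atTop (𝓝 0) := ht.mono_right nhdsWithin_le_nhds
  have htpos : ∀ᶠ k in atTop, 0 < t k := ht.eventually self_mem_nhdsWithin
  have hs : Tendsto (fun k => t k ^ 2 / 2) atTop (𝓝[>] 0) := by
    refine tendsto_nhdsWithin_iff.2 ⟨by simpa using (ht0.pow 2).div_const 2, ?_⟩
    filter_upwards [htpos] with k hk
    exact Set.mem_Ioi.2 (by positivity)
  have hp : Tendsto (fun k => x + t k • w + (t k ^ 2 / 2) • a) atTop (𝓝 x) := by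
    simpa using (tendsto_const_nhds.add (ht0.smul_const w)).add
      (((ht0.pow 2).div_const 2).smul_const a)
  have hr : Tendsto (fun k => (t k ^ 2 / 2)⁻¹ • (f (x + t k • w + (t k ^ 2 / 2) • a) -
      (f x + t k • fderiv ℝ f x w + (t k ^ 2 / 2) • z' k))) atTop
      (𝓝 (fderiv ℝ f x a + fderiv ℝ (fderiv ℝ f) x w w - z)) := by
    refine ((hf.tendsto_parabolic ht tendsto_const_nhds).sub hz').congr' ?_
    filter_upwards [htpos] with k hk
    have hk' : t k ^ 2 / 2 ≠ 0 := by positivity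
    rw [← sub_sub, ← sub_sub, smul_sub _ _ ((t k ^ 2 / 2) • z' k), inv_smul_smul₀ hk']
  -- The correction is made at scale `t²/2`, so it changes only the second-order term.
  obtain ⟨ψ, u, u₀, hψ, hu, hub, hmem'⟩ := h.exists_feasible_correction hs hp hmem hr
  refine ⟨a + u₀, ⟨fun k => t (ψ k), fun k => a + u k, ht.comp hψ.tendsto_atTop,
    tendsto_const_nhds.add hu, fun k => ?_⟩, by simpa using hub⟩
  have := hmem' k
  rwa [add_assoc, ← smul_add] at this

theorem secondOrderForm_eq {φ : E → ℝ} {f : E → F} {x : E} (hφ : TwiceDifferentiableAt φ x)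
    (hf : TwiceDifferentiableAt f x) (Θ : Set F) (w : E) (lam : F) :
    secondOrderForm φ f Θ x w lam =
      ((fderiv ℝ (fderiv ℝ φ) x w w + inner ℝ lam (fderiv ℝ (fderiv ℝ f) x w w) : ℝ) : EReal) +
        secondSubderivative (indicatorFun Θ) (f x) lam (fderiv ℝ f x w) := by
  rw [secondOrderForm, hφ.fderiv_fderiv_lagrangian hf]

end ChainRules

/-! ### Weak and strong duality for the second-order problem. -/

section Multipliers

variable {E F : Type*} [NormedAddCommGroup E] [InnerProductSpace ℝ E] [CompleteSpace E]
  [NormedAddCommGroup F] [InnerProductSpace ℝ F] [CompleteSpace F]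

theorem inner_fderiv_eq_of_mem_lagrangeMultipliers {f : E → F} {Θ : Set F} {x v : E} {lam : F}
    (hlam : lam ∈ lagrangeMultipliers f Θ x v) (w : E) :
    inner ℝ lam (fderiv ℝ f x w) = inner ℝ v w := by
  rw [← ContinuousLinearMap.adjoint_inner_left, hlam.2]

theorem fderiv_mem_criticalCone {f : E → F} {Θ : Set F} {x v w : E} {lam : F}
    (hf : DifferentiableAt ℝ f x) (hlam : lam ∈ lagrangeMultipliers f Θ x v)
    (hw : w ∈ criticalCone {z | f z ∈ Θ} x v) :
    fderiv ℝ f x w ∈ criticalCone Θ (f x) lam :=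
  ⟨fderiv_mem_tangentCone hf hw.1,
    (inner_fderiv_eq_of_mem_lagrangeMultipliers hlam w).trans hw.2⟩

theorem LocalErrorBound.exists_multiplier_of_secondTangentSet [FiniteDimensional ℝ E] {f : E → F}
    {Θ : Set F} {x : E} {κ : ℝ} (h : LocalErrorBound f Θ x κ) (hκ : 0 ≤ κ) (hΘ : Convex ℝ Θ)
    (hx : f x ∈ Θ) (hf : TwiceDifferentiableAt f x) {v w : E}
    (hder : ParabolicallyDerivable Θ (f x) (fderiv ℝ f x w)) {p : ℝ}
    (hp : ∀ a ∈ secondTangentSet {z | f z ∈ Θ} x w, p ≤ -inner ℝ v a) :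
    ∃ lam ∈ lagrangeMultipliers f Θ x v, ∀ z ∈ secondTangentSet Θ (f x) (fderiv ℝ f x w),
      p ≤ inner ℝ lam (fderiv ℝ (fderiv ℝ f) x w w - z) := by
  obtain ⟨lam, -, hadj, hlam⟩ := exists_multiplier_of_exact_penalty
    (hder.convex_secondTangentSet hΘ) hder.1 (fderiv ℝ f x) (fderiv ℝ (fderiv ℝ f) x w w) v p
    (mul_nonneg (norm_nonneg v) hκ) fun a z hz => by
      obtain ⟨a', ha', hle⟩ := h.exists_mem_secondTangentSet hf hz a
      have h1 := hp a' ha'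
      have h2 : -inner ℝ v (a' - a) ≤ ‖v‖ * ‖a' - a‖ :=
        (neg_le_abs _).trans (abs_real_inner_le_norm _ _)
      have h3 := mul_le_mul_of_nonneg_left hle (norm_nonneg v)
      rw [inner_sub_right] at h2
      linarith
  refine ⟨lam, ⟨mem_limitingNormalCone_of_forall_inner_nonpos hx fun θ hθ => ?_, hadj⟩, hlam⟩
  obtain ⟨z, hz⟩ := hder.1
  by_contra! hpos
  set d := inner ℝ lam (θ - f x)
  set c := inner ℝ lam (fderiv ℝ (fderiv ℝ f) x w w - z)
  have h0 : p ≤ c := hlam z hz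
  -- This step length makes the right-hand side equal to `p - 1`.
  have h1 := hlam _ (add_smul_sub_mem_secondTangentSet hΘ hz hθ
    (s := (c - p + 1) / d) (div_nonneg (by linarith) hpos.le))
  rw [← sub_sub, inner_sub_right, inner_smul_right, div_mul_cancel₀ _ hpos.ne'] at h1
  linarith

/-- Weak duality: the derivative maps `a` to a second-order tangent of `Θ` up to the curvature term
of `f`, and the adjoint equation turns the pairing with `lam` into one with `v`. -/
theorem secondOrderForm_le {φ : E → ℝ} {f : E → F} {Θ : Set F} {x v w a : E} {lam : F}
    (hφ : TwiceDifferentiableAt φ x) (hf : TwiceDifferentiableAt f x) (hx : f x ∈ Θ)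
    (hlam : lam ∈ lagrangeMultipliers f Θ x v) (hw : inner ℝ v w = 0)
    (ha : a ∈ secondTangentSet {z | f z ∈ Θ} x w) :
    secondOrderForm φ f Θ x w lam ≤
      ((fderiv ℝ (fderiv ℝ φ) x w w - inner ℝ v a : ℝ) : EReal) := by
  rw [secondOrderForm_eq hφ hf]
  have h1 := secondSubderivative_indicatorFun_le hx
    ((inner_fderiv_eq_of_mem_lagrangeMultipliers hlam w).trans hw)
    (fderiv_add_mem_secondTangentSet hf ha)
  refine (add_le_add_right h1 _).trans (le_of_eq ?_)
  rw [← EReal.coe_add, inner_add_right, inner_fderiv_eq_of_mem_lagrangeMultipliers hlam]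
  congr 1
  ring

theorem exists_secondOrderForm_eq [FiniteDimensional ℝ F] {φ : E → ℝ} {f : E → F} {Θ : Set F}
    {x v w : E} {lam : F} (hφ : TwiceDifferentiableAt φ x) (hf : TwiceDifferentiableAt f x)
    (hx : f x ∈ Θ) (hlam : lam ∈ lagrangeMultipliers f Θ x v) (hw : inner ℝ v w = 0)
    (hder : ParabolicallyDerivable Θ (f x) (fderiv ℝ f x w))
    (hreg : ParabolicallyRegular Θ (f x) lam) :
    ∃ z ∈ secondTangentSet Θ (f x) (fderiv ℝ f x w), secondOrderForm φ f Θ x w lam =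
      ((fderiv ℝ (fderiv ℝ φ) x w w +
        inner ℝ lam (fderiv ℝ (fderiv ℝ f) x w w - z) : ℝ) : EReal) := by
  have h0 := (inner_fderiv_eq_of_mem_lagrangeMultipliers hlam w).trans hw
  obtain ⟨z₀, hz₀⟩ := hder.1
  obtain ⟨z, hz, hzeq⟩ := hreg.exists_secondSubderivative_eq hx h0
    ((secondSubderivative_indicatorFun_le hx h0 hz₀).trans_lt (EReal.coe_lt_top _))
  refine ⟨z, hz, ?_⟩
  rw [secondOrderForm_eq hφ hf, hzeq, ← EReal.coe_add, inner_sub_right]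
  congr 1
  ring

/-- Strong duality: the separating multiplier bounds the pairing at every second-order tangent of
`Θ`, in particular at the one realizing `secondOrderForm`. -/
theorem LocalErrorBound.exists_le_secondOrderForm [FiniteDimensional ℝ E]
    [FiniteDimensional ℝ F] {φ : E → ℝ} {f : E → F} {Θ : Set F} {x : E} {κ : ℝ}
    (h : LocalErrorBound f Θ x κ) (hκ : 0 ≤ κ) (hΘ : Convex ℝ Θ) (hx : f x ∈ Θ)
    (hφ : TwiceDifferentiableAt φ x) (hf : TwiceDifferentiableAt f x) {v w : E}
    (hw : inner ℝ v w = 0) (hder : ParabolicallyDerivable Θ (f x) (fderiv ℝ f x w))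
    (hreg : ∀ lam ∈ lagrangeMultipliers f Θ x v, ParabolicallyRegular Θ (f x) lam) {p : ℝ}
    (hp : ∀ a ∈ secondTangentSet {z | f z ∈ Θ} x w,
      p ≤ fderiv ℝ (fderiv ℝ φ) x w w - inner ℝ v a) :
    ∃ lam ∈ lagrangeMultipliers f Θ x v, (p : EReal) ≤ secondOrderForm φ f Θ x w lam := by
  obtain ⟨lam, hlam, hle⟩ := h.exists_multiplier_of_secondTangentSet hκ hΘ hx hf (v := v) hder
    (p := p - fderiv ℝ (fderiv ℝ φ) x w w) fun a ha => by linarith [hp a ha]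
  refine ⟨lam, hlam, ?_⟩
  obtain ⟨z, hz, heq⟩ := exists_secondOrderForm_eq hφ hf hx hlam hw hder (hreg lam hlam)
  rw [heq, EReal.coe_le_coe_iff]
  linarith [hle z hz]

theorem LocalErrorBound.exists_isMaxOn_secondOrderForm [FiniteDimensional ℝ E]
    [FiniteDimensional ℝ F] {φ : E → ℝ} {f : E → F} {Θ : Set F} {x : E} {κ : ℝ}
    (h : LocalErrorBound f Θ x κ) (hκ : 0 ≤ κ) (hΘ : Convex ℝ Θ) (hx : f x ∈ Θ)
    (hφ : TwiceDifferentiableAt φ x) (hf : TwiceDifferentiableAt f x) {v w : E}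
    (hw : inner ℝ v w = 0) (hder : ParabolicallyDerivable Θ (f x) (fderiv ℝ f x w))
    (hreg : ∀ lam ∈ lagrangeMultipliers f Θ x v, ParabolicallyRegular Θ (f x) lam)
    (hne : (lagrangeMultipliers f Θ x v).Nonempty) :
    ∃ lam ∈ lagrangeMultipliers f Θ x v,
      IsMaxOn (secondOrderForm φ f Θ x w) (lagrangeMultipliers f Θ x v) lam := by
  set T := secondTangentSet {z | f z ∈ Θ} x w with hT
  set val : E → ℝ := fun a => fderiv ℝ (fderiv ℝ φ) x w w - inner ℝ v a with hval
  have hTne : (val '' T).Nonempty := by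
    obtain ⟨z, hz⟩ := hder.1
    obtain ⟨a, ha, -⟩ := h.exists_mem_secondTangentSet hf hz 0
    exact ⟨_, a, ha, rfl⟩
  have hform : ∀ lam ∈ lagrangeMultipliers f Θ x v, ∃ r : ℝ,
      secondOrderForm φ f Θ x w lam = r ∧ ∀ a ∈ T, r ≤ val a := by
    intro lam hlam
    obtain ⟨z, -, heq⟩ := exists_secondOrderForm_eq hφ hf hx hlam hw hder (hreg lam hlam)
    refine ⟨_, heq, fun a ha => ?_⟩
    have := secondOrderForm_le hφ hf hx hlam hw ha
    rwa [heq, EReal.coe_le_coe_iff] at this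
  obtain ⟨lam₀, hlam₀⟩ := hne
  obtain ⟨r₀, -, hr₀⟩ := hform lam₀ hlam₀
  have hbdd : BddBelow (val '' T) := ⟨r₀, by rintro _ ⟨a, ha, rfl⟩; exact hr₀ a ha⟩
  -- With `p` the primal infimum, finite by weak duality, the resulting multiplier dominates all
  -- others.
  obtain ⟨lam, hlam, hle⟩ := h.exists_le_secondOrderForm hκ hΘ hx hφ hf hw hder hreg
    (p := sInf (val '' T)) fun a ha => csInf_le hbdd ⟨a, ha, rfl⟩
  refine ⟨lam, hlam, fun lam' hlam' => ?_⟩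
  obtain ⟨r, hr, hra⟩ := hform lam' hlam'
  have h1 : r ≤ sInf (val '' T) :=
    le_csInf hTne (by rintro _ ⟨a, ha, rfl⟩; exact hra a ha)
  simp only [Set.mem_ofPred_eq]
  rw [hr]
  exact (EReal.coe_le_coe_iff.2 h1).trans hle

end Multipliers

end VarAnalysis

namespace VarAnalysis

/-! ### Quadratic growth and the second-order conditions. -/

section Optimality

variable {E F : Type*} [NormedAddCommGroup E] [InnerProductSpace ℝ E]
  [NormedAddCommGroup F] [InnerProductSpace ℝ F]

theorem le_of_growth_of_mem_secondTangentSet {φ : E → ℝ} {Ω : Set E} {x v w a : E} {l : ℝ}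
    (hφ : TwiceDifferentiableAt φ x) (hv : ∀ u, inner ℝ v u = -fderiv ℝ φ x u)
    (hgrowth : ∀ᶠ z in 𝓝[Ω] x, φ x + l / 2 * ‖z - x‖ ^ 2 ≤ φ z) (hw : inner ℝ v w = 0)
    (ha : a ∈ secondTangentSet Ω x w) :
    l * ‖w‖ ^ 2 ≤ fderiv ℝ (fderiv ℝ φ) x w w - inner ℝ v a := by
  obtain ⟨t, a', ht, ha', hmem⟩ := ha
  have ht0 : Tendsto t atTop (𝓝 0) := ht.mono_right nhdsWithin_le_nhds
  have htpos : ∀ᶠ k in atTop, 0 < t k := ht.eventually self_mem_nhdsWithin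
  have hlim := hφ.tendsto_parabolic (w := w) ht ha'
  rw [hv, neg_eq_zero] at hw
  have hcurve : Tendsto (fun k => x + t k • w + (t k ^ 2 / 2) • a' k) atTop (𝓝[Ω] x) := by
    refine tendsto_nhdsWithin_iff.2 ⟨?_, Eventually.of_forall hmem⟩
    simpa using (tendsto_const_nhds.add (ht0.smul_const w)).add
      (((ht0.pow 2).div_const 2).smul ha')
  have hlower : Tendsto (fun k => l * ‖w + (t k / 2) • a' k‖ ^ 2) atTop (𝓝 (l * ‖w‖ ^ 2)) := by
    have h1 : Tendsto (fun k => w + (t k / 2) • a' k) atTop (𝓝 w) := by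
      simpa using tendsto_const_nhds.add ((ht0.div_const 2).smul ha')
    exact (h1.norm.pow 2).const_mul l
  rw [hv, sub_neg_eq_add, add_comm]
  refine le_of_tendsto_of_tendsto hlower hlim ?_
  filter_upwards [htpos, hcurve.eventually hgrowth] with k hk hg
  have hk' : 0 < t k ^ 2 / 2 := by positivity
  have e : x + t k • w + (t k ^ 2 / 2) • a' k - x = t k • (w + (t k / 2) • a' k) := by
    rw [smul_add, smul_smul, show t k * (t k / 2) = t k ^ 2 / 2 by ring]
    abel
  rw [e, norm_smul, mul_pow, Real.norm_eq_abs, sq_abs] at hg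
  rw [hw, smul_zero, sub_zero, smul_eq_mul, le_inv_mul_iff₀ hk']
  linarith

theorem exists_growth_of_forall_secondOrderForm_pos [FiniteDimensional ℝ E] [CompleteSpace E]
    [CompleteSpace F] {φ : E → ℝ} {f : E → F} {Θ : Set F} {x v : E} (hΘ : Convex ℝ Θ)
    (hx : f x ∈ Θ) (hφ : TwiceDifferentiableAt φ x) (hf : TwiceDifferentiableAt f x)
    (hv : ∀ u, inner ℝ v u = -fderiv ℝ φ x u) (hne : (lagrangeMultipliers f Θ x v).Nonempty)
    (hpos : ∀ w ∈ criticalCone {z | f z ∈ Θ} x v, w ≠ 0 →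
      ∃ lam ∈ lagrangeMultipliers f Θ x v, 0 < secondOrderForm φ f Θ x w lam) :
    ∃ l > (0 : ℝ), ∃ ε > (0 : ℝ), ∀ z ∈ Metric.closedBall x ε, f z ∈ Θ →
      φ x + l / 2 * ‖z - x‖ ^ 2 ≤ φ z := by
  by_contra! hcon
  have hex : ∀ k : ℕ, ∃ z ∈ Metric.closedBall x (1 / ((k : ℝ) + 1)), f z ∈ Θ ∧
      φ z < φ x + 1 / ((k : ℝ) + 1) / 2 * ‖z - x‖ ^ 2 := fun k =>
    hcon _ Nat.one_div_pos_of_nat _ Nat.one_div_pos_of_nat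
  choose z hzball hzmem hzlt using hex
  have htpos' : ∀ k, 0 < ‖z k - x‖ := fun k => by
    refine norm_pos_iff.2 fun h0 => ?_
    have := hzlt k
    rw [h0, sub_eq_zero.1 h0] at this
    simp at this
  have hbdd : ∀ k, ‖z k - x‖⁻¹ • (z k - x) ∈ Metric.closedBall (0 : E) 1 := fun k => by
    rw [mem_closedBall_zero_iff, norm_smul, norm_inv, norm_norm, inv_mul_cancel₀ (htpos' k).ne']
  obtain ⟨w, -, σ, hσ, hw⟩ := tendsto_subseq_of_bounded Metric.isBounded_closedBall hbdd
  set t : ℕ → ℝ := fun k => ‖z (σ k) - x‖ with ht_def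
  set w' : ℕ → E := fun k => (t k)⁻¹ • (z (σ k) - x) with hw'_def
  replace hw : Tendsto w' atTop (𝓝 w) := hw
  have htpos : ∀ k, 0 < t k := fun k => htpos' (σ k)
  have hε : Tendsto (fun k => 1 / ((σ k : ℝ) + 1)) atTop (𝓝 0) :=
    tendsto_one_div_add_atTop_nhds_zero_nat.comp hσ.tendsto_atTop
  have ht0 : Tendsto t atTop (𝓝 0) :=
    squeeze_zero (fun k => (htpos k).le) (fun k => by
      have := hzball (σ k); rwa [Metric.mem_closedBall, dist_eq_norm] at this) hε
  have ht : Tendsto t atTop (𝓝[>] 0) :=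
    tendsto_nhdsWithin_iff.2 ⟨ht0, Eventually.of_forall htpos⟩
  have hz : ∀ k, x + t k • w' k = z (σ k) := fun k => by
    rw [hw'_def, smul_inv_smul₀ (htpos k).ne', add_sub_cancel]
  have hwnorm : ‖w‖ = 1 := by
    refine tendsto_nhds_unique hw.norm (tendsto_const_nhds.congr fun k => ?_)
    rw [hw'_def, norm_smul, norm_inv, ht_def, norm_norm, inv_mul_cancel₀ (htpos k).ne']
  have hφlt : ∀ k, φ (x + t k • w' k) - φ x < 1 / ((σ k : ℝ) + 1) / 2 * t k ^ 2 := fun k => by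
    rw [hz]; linarith [hzlt (σ k)]
  have htan : w ∈ tangentCone {z | f z ∈ Θ} x :=
    ⟨t, w', ht, hw, fun k => by rw [hz]; exact hzmem (σ k)⟩
  have hnormal : ∀ lam ∈ lagrangeMultipliers f Θ x v, ∀ θ ∈ Θ, inner ℝ lam (θ - f x) ≤ 0 :=
    fun lam hlam => (mem_limitingNormalCone_iff_of_convex hΘ hx).1 hlam.1
  have hfx := hf.1.self_of_nhds
  have hcrit : w ∈ criticalCone {z | f z ∈ Θ} x v := by
    refine ⟨htan, le_antisymm ?_ ?_⟩
    · obtain ⟨lam, hlam⟩ := hne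
      -- Normality of a multiplier gives one sign; the failure of growth gives the other.
      rw [← inner_fderiv_eq_of_mem_lagrangeMultipliers hlam]
      exact inner_nonpos_of_mem_tangentCone (hnormal lam hlam) (fderiv_mem_tangentCone hfx htan)
    · rw [hv, neg_nonneg]
      have h1 := tendsto_quotient_of_hasFDerivAt hφ.1.self_of_nhds.hasFDerivAt ht hw
      have h2 : Tendsto (fun k => 1 / ((σ k : ℝ) + 1) / 2 * t k) atTop (𝓝 0) := by
        simpa using (hε.div_const 2).mul ht0
      refine le_of_tendsto_of_tendsto' h1 h2 fun k => ?_
      rw [smul_eq_mul, inv_mul_le_iff₀ (htpos k)]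
      linarith [hφlt k]
  obtain ⟨lam, hlam, hform⟩ := hpos w hcrit (norm_pos_iff.1 (by rw [hwnorm]; exact one_pos))
  rw [secondOrderForm_eq hφ hf] at hform
  set s : ℝ := fderiv ℝ (fderiv ℝ φ) x w w + inner ℝ lam (fderiv ℝ (fderiv ℝ f) x w w)
  have hlt : ((-s : ℝ) : EReal) <
      secondSubderivative (indicatorFun Θ) (f x) lam (fderiv ℝ f x w) := by
    by_contra! hle
    refine hform.not_ge ((add_le_add_right hle _).trans (le_of_eq ?_))
    rw [← EReal.coe_add, add_neg_cancel, EReal.coe_zero]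
  -- A real number in between is needed because the second subderivative may be `⊤`.
  obtain ⟨c, hc₁, hc₂⟩ := EReal.lt_iff_exists_real_btwn.1 hlt
  have hc : 0 < s + c := by
    have := EReal.coe_lt_coe_iff.1 hc₁
    linarith
  set u : ℕ → F := fun k => (t k)⁻¹ • (f (x + t k • w' k) - f x) with hu_def
  have hu : Tendsto u atTop (𝓝 (fderiv ℝ f x w)) :=
    tendsto_quotient_of_hasFDerivAt hfx.hasFDerivAt ht hw
  have hev := eventually_lt_of_lt_liminf (hc₂.trans_le (secondSubderivative_le_liminf ht hu))
  have hlim := (hφ.tendsto_quotient ht hw).add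
    ((tendsto_const_nhds (x := lam)).inner (hf.tendsto_quotient ht hw))
  refine hc.not_ge (le_of_tendsto_of_tendsto (hlim.add_const c) hε ?_)
  filter_upwards [hev] with k hk
  have hkpos := htpos k
  have huk : f x + t k • u k = f (x + t k • w' k) := by
    rw [hu_def, smul_inv_smul₀ hkpos.ne', add_sub_cancel]
  rw [secondQuotient_indicatorFun_of_mem hx hkpos (by rw [huk, hz]; exact hzmem (σ k)),
    EReal.coe_lt_coe_iff, hu_def, inner_smul_right] at hk
  have h1 := hφlt k
  have h2 : inner ℝ lam (fderiv ℝ f x (w' k)) = -fderiv ℝ φ x (w' k) := by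
    rw [inner_fderiv_eq_of_mem_lagrangeMultipliers hlam, hv]
  rw [inner_smul_right, inner_sub_right, inner_smul_right, h2, smul_eq_mul, smul_eq_mul]
  set D := φ (x + t k • w' k) - φ x
  set G := inner ℝ lam (f (x + t k • w' k) - f x)
  -- The first-order terms cancel by stationarity of the Lagrangian, and the indicator quotient
  -- removes `G`. What remains is the quotient of `φ`, which is at most `1 / (σ k + 1)`; in the
  -- limit `s + c ≤ 0`.
  have h3 : (t k ^ 2 / 2)⁻¹ * (D - t k * fderiv ℝ φ x (w' k)) +
      (t k ^ 2 / 2)⁻¹ * (G - t k * -fderiv ℝ φ x (w' k)) - 2 / t k * ((t k)⁻¹ * G)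
      = (t k ^ 2 / 2)⁻¹ * D := by
    field_simp
    ring
  have h4 : (t k ^ 2 / 2)⁻¹ * D ≤ 1 / ((σ k : ℝ) + 1) := by
    rw [inv_mul_le_iff₀ (by positivity)]
    linarith
  linarith

end Optimality

theorem essentialObjective_add_le_iff {E F : Type*} {φ : E → ℝ} {f : E → F} {Θ : Set F} {x : E}
    (hx : f x ∈ Θ) {r : ℝ} {z : E} :
    essentialObjective φ f Θ x + (r : EReal) ≤ essentialObjective φ f Θ z ↔
      (f z ∈ Θ → φ x + r ≤ φ z) := by
  rw [essentialObjective, essentialObjective, indicatorFun, indicatorFun, if_pos hx, add_zero]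
  by_cases hz : f z ∈ Θ
  · rw [if_pos hz, add_zero, ← EReal.coe_add, EReal.coe_le_coe_iff]
    exact ⟨fun h _ => h, fun h => h hz⟩
  · rw [if_neg hz, EReal.coe_add_top]
    exact ⟨fun _ h => absurd h hz, fun _ => le_top⟩

end VarAnalysis

/-! ### Assembly of the theorem. -/

theorem theorem7p1 {n m : ℕ}
    (φ : EuclideanSpace ℝ (Fin n) → ℝ)
    (f : EuclideanSpace ℝ (Fin n) → EuclideanSpace ℝ (Fin m))
    (Θ : Set (EuclideanSpace ℝ (Fin m)))
    (Ω : Set (EuclideanSpace ℝ (Fin n))) (hΩ : Ω = {x | f x ∈ Θ})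
    (xbar : EuclideanSpace ℝ (Fin n)) (hfeas : f xbar ∈ Θ)
    (vbar : EuclideanSpace ℝ (Fin n)) (hvbar : vbar = -gradient φ xbar)
    (hφ : TwiceDifferentiableAt φ xbar)
    (hΘclosed : IsClosed Θ)
    (H1 : vbar ∈ limitingNormalCone Ω xbar)
    (H2convex : Convex ℝ Θ) (H2diff : TwiceDifferentiableAt f xbar)
    (κ : ℝ) (hκ : 0 < κ) (H3 : MSCQ f Θ xbar κ)
    (H4 : ∀ lam ∈ lagrangeMultipliers f Θ xbar vbar, ∀ w : EuclideanSpace ℝ (Fin n),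
      fderiv ℝ f xbar w ∈ criticalCone Θ (f xbar) lam →
        ParabolicallyDerivable Θ (f xbar) (fderiv ℝ f xbar w))
    (hreg : ∀ lam ∈ lagrangeMultipliers f Θ xbar vbar, ParabolicallyRegular Θ (f xbar) lam) :
    -- for every critical direction the maximum over the multipliers is attained
    (∀ w ∈ criticalCone Ω xbar vbar, ∃ lam ∈ lagrangeMultipliers f Θ xbar vbar,
      IsMaxOn (secondOrderForm φ f Θ xbar w) (lagrangeMultipliers f Θ xbar vbar) lam) ∧
    -- (i) the second-order necessary condition
    (IsLocalMinOn φ Ω xbar → ∀ w ∈ criticalCone Ω xbar vbar,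
      0 ≤ ⨆ lam ∈ lagrangeMultipliers f Θ xbar vbar, secondOrderForm φ f Θ xbar w lam) ∧
    -- (ii) the second-order sufficient condition is equivalent to quadratic growth
    ((∀ w ∈ criticalCone Ω xbar vbar, w ≠ 0 →
        0 < ⨆ lam ∈ lagrangeMultipliers f Θ xbar vbar, secondOrderForm φ f Θ xbar w lam) ↔
      ∃ l > (0 : ℝ), ∃ ε > (0 : ℝ), ∀ x ∈ Metric.closedBall xbar ε,
        essentialObjective φ f Θ xbar + ((l / 2 * ‖x - xbar‖ ^ 2 : ℝ) : EReal) ≤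
          essentialObjective φ f Θ x) ∧
    -- under the second-order sufficient condition, a strict local minimum
    ((∀ w ∈ criticalCone Ω xbar vbar, w ≠ 0 →
        0 < ⨆ lam ∈ lagrangeMultipliers f Θ xbar vbar, secondOrderForm φ f Θ xbar w lam) →
      ∀ᶠ x in 𝓝[≠] xbar, x ∈ Ω → φ xbar < φ x) := by
  subst hΩ
  have hv : ∀ u, inner ℝ vbar u = -fderiv ℝ φ xbar u := fun u => by
    rw [hvbar, inner_neg_left, inner_gradient_left]
  have hbound := H3.localErrorBound hκ
  have hne : (lagrangeMultipliers f Θ xbar vbar).Nonempty :=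
    hbound.lagrangeMultipliers_nonempty hκ.le H2convex hfeas H2diff H1
  have hder : ∀ w ∈ criticalCone {x | f x ∈ Θ} xbar vbar,
      ParabolicallyDerivable Θ (f xbar) (fderiv ℝ f xbar w) := fun w hw => by
    obtain ⟨lam, hlam⟩ := hne
    exact H4 lam hlam w (fderiv_mem_criticalCone H2diff.1.self_of_nhds hlam hw)
  -- One estimate serves twice: `l = 0` for local minimizers, `l > 0` for quadratic growth.
  have hnecessary : ∀ l : ℝ,
      (∀ᶠ z in 𝓝[{x | f x ∈ Θ}] xbar, φ xbar + l / 2 * ‖z - xbar‖ ^ 2 ≤ φ z) →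
      ∀ w ∈ criticalCone {x | f x ∈ Θ} xbar vbar, ((l * ‖w‖ ^ 2 : ℝ) : EReal) ≤
        ⨆ lam ∈ lagrangeMultipliers f Θ xbar vbar, secondOrderForm φ f Θ xbar w lam := by
    intro l hgrowth w hw
    obtain ⟨lam, hlam, hle⟩ := hbound.exists_le_secondOrderForm hκ.le H2convex hfeas hφ H2diff
      hw.2 (hder w hw) hreg fun a ha =>
        le_of_growth_of_mem_secondTangentSet hφ hv hgrowth hw.2 ha
    exact hle.trans (le_iSup₂ (f := fun lam _ => secondOrderForm φ f Θ xbar w lam) lam hlam)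
  have hsufficient : (∀ w ∈ criticalCone {x | f x ∈ Θ} xbar vbar, w ≠ 0 →
        0 < ⨆ lam ∈ lagrangeMultipliers f Θ xbar vbar, secondOrderForm φ f Θ xbar w lam) →
      ∃ l > (0 : ℝ), ∃ ε > (0 : ℝ), ∀ z ∈ Metric.closedBall xbar ε, f z ∈ Θ →
        φ xbar + l / 2 * ‖z - xbar‖ ^ 2 ≤ φ z := fun hpos =>
    exists_growth_of_forall_secondOrderForm_pos H2convex hfeas hφ H2diff hv hne
      -- A positive supremum already provides one multiplier with positive value, without
      -- attainment.
      fun w hw hw0 => by simpa only [lt_iSup_iff, exists_prop] using hpos w hw hw0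
  refine ⟨fun w hw => ?_, fun hmin w hw => ?_, ⟨fun hpos => ?_, ?_⟩, fun hpos => ?_⟩
  · exact hbound.exists_isMaxOn_secondOrderForm hκ.le H2convex hfeas hφ H2diff hw.2 (hder w hw)
      hreg hne
  · have hgrowth : ∀ᶠ z in 𝓝[{x | f x ∈ Θ}] xbar,
        φ xbar + (0 : ℝ) / 2 * ‖z - xbar‖ ^ 2 ≤ φ z := by
      filter_upwards [hmin] with z hz
      simpa using hz
    simpa using hnecessary 0 hgrowth w hw
  · obtain ⟨l, hl, ε, hε, hgrowth⟩ := hsufficient hpos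
    exact ⟨l, hl, ε, hε, fun z hz => (essentialObjective_add_le_iff hfeas).2 (hgrowth z hz)⟩
  · rintro ⟨l, hl, ε, hε, hgrowth⟩ w hw hw0
    refine lt_of_lt_of_le ?_ (hnecessary l ?_ w hw)
    · have : 0 < l * ‖w‖ ^ 2 := mul_pos hl (pow_pos (norm_pos_iff.2 hw0) 2)
      exact_mod_cast this
    · filter_upwards [self_mem_nhdsWithin,
        mem_nhdsWithin_of_mem_nhds (Metric.closedBall_mem_nhds xbar hε)] with z hz hzball
      exact (essentialObjective_add_le_iff hfeas).1 (hgrowth z hzball) hz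
  · obtain ⟨l, hl, ε, hε, hgrowth⟩ := hsufficient hpos
    filter_upwards [self_mem_nhdsWithin,
      mem_nhdsWithin_of_mem_nhds (Metric.closedBall_mem_nhds xbar hε)] with z hz hzball hzmem
    have h1 := hgrowth z hzball hzmem
    have h2 : 0 < ‖z - xbar‖ := norm_pos_iff.2 (sub_ne_zero.2 hz)
    have h3 : 0 < l / 2 * ‖z - xbar‖ ^ 2 := by positivity
    linarith
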